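/- All graphs are finite and simple. The average degree of a graph $G$ is $2|E(G)|/|V(G)|$, and $G$ is called $C_\ell$-free if it contains no cycle of length $\ell$ (as a not necessarily induced subgraph). Let $k, \ell$ be integers with $3 \le \ell < k$, and let $d_k(\ell)$ be the largest average degree of a bipartite $C_\ell$-free graph on exactly $k$ vertices. (i) Every $C_\ell$-free graph $G$ of average degree at least $96\, d_k(\ell)$ contains cycles of $k$ consecutive even lengths: there is an integer $m$ such that $G$ contains a cycle of length $2m + 2i$ for every $i \in \{0, 1, \dots, k-1\}$. (ii) Suppose moreover that $k\mathbb{Z} + \ell$ contains an even integer (that is, $k$ is odd or $\ell$ is even). Let $c_k(\ell)$ be the infimum of all real numbers $c$ such that every graph of average degree at least $c$ contains a cycle whose length is congruent to $\ell$ modulo $k$. Then every graph of average degree at least $96\, d_k(\ell)$ contains a cycle whose length is congruent to $\ell$ modulo $k$, and \[ d_k(\ell) \le c_k(\ell) \le 96\, d_k(\ell). \] -/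

import Mathlib

namespace CycleLengths

open Classical in
/-- The average degree of a finite graph (`0` when there are no vertices). -/
noncomputable def avgDegree {V : Type*} [Fintype V] (G : SimpleGraph V) : ℝ :=
  (∑ v : V, (G.degree v : ℝ)) / (Fintype.card V : ℝ)

/-- `G` contains a cycle with exactly `n` edges. -/
def HasCycle {V : Type*} (G : SimpleGraph V) (n : ℕ) : Prop :=
  ∃ (v : V) (p : G.Walk v v), p.IsCycle ∧ p.length = n

/-- `G` contains cycles of `k` consecutive even lengths `2m, 2m + 2, …, 2m + 2(k - 1)`. -/
def HasConsecutiveEvenCycles {V : Type*} (G : SimpleGraph V) (k : ℕ) : Prop :=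
  ∃ m : ℕ, ∀ i < k, HasCycle G (2 * m + 2 * i)

/-- `G` contains a cycle of length congruent to `ℓ` modulo `k`. -/
def HasCycleMod {V : Type*} (G : SimpleGraph V) (k ℓ : ℕ) : Prop :=
  ∃ n : ℕ, n ≡ ℓ [MOD k] ∧ HasCycle G n

/-- The average degrees of the bipartite graphs on `k` vertices without a cycle of length `ℓ`. -/
def bipartiteFreeAvgDegrees (k ℓ : ℕ) : Set ℝ :=
  {d | ∃ G : SimpleGraph (Fin k), G.IsBipartite ∧ ¬ HasCycle G ℓ ∧ avgDegree G = d}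

/-- `d_k(ℓ)`: the largest average degree of a `k`-vertex bipartite graph without a cycle of
length `ℓ`. -/
noncomputable def maxDeg (k ℓ : ℕ) : ℝ := sSup (bipartiteFreeAvgDegrees k ℓ)

/-- The supremum defining `d_k(ℓ)` is a maximum: finitely many graphs are considered, among them
the graph without edges. -/
theorem isGreatest_maxDeg (k : ℕ) {ℓ : ℕ} :
    IsGreatest (bipartiteFreeAvgDegrees k ℓ) (maxDeg k ℓ) := by
  have hfin : (bipartiteFreeAvgDegrees k ℓ).Finite := by
    refine (Set.finite_range (fun G : SimpleGraph (Fin k) => avgDegree G)).subset ?_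
    rintro d ⟨G, -, -, rfl⟩
    exact ⟨G, rfl⟩
  have hne : (bipartiteFreeAvgDegrees k ℓ).Nonempty := by
    refine ⟨_, ⊥, ⟨SimpleGraph.Coloring.mk (fun _ => 0) (by simp)⟩, ?_, rfl⟩
    rintro ⟨v, p, hp, -⟩
    cases p with
    | nil => exact hp.ne_nil rfl
    | cons h _ => simp at h
  exact ⟨hne.csSup_mem hfin, fun d hd => le_csSup hfin.bddAbove hd⟩

/-- The real numbers `c` such that every finite graph of average degree at least `c` contains a
cycle of length `ℓ` modulo `k`. -/
def cycleModThresholds (k ℓ : ℕ) : Set ℝ :=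
  {c | ∀ (V : Type) [Fintype V] (G : SimpleGraph V), c ≤ avgDegree G → HasCycleMod G k ℓ}

/-- `c_k(ℓ)`: the average-degree threshold that forces a cycle of length `ℓ` modulo `k`. -/
noncomputable def cycleModThreshold (k ℓ : ℕ) : ℝ := sInf (cycleModThresholds k ℓ)

end CycleLengths

/-! Write `d` for `maxDeg k ℓ`. In a `C_ℓ`-free graph of average degree at least `96 d`, a cut keeps
half of the edges and makes the graph bipartite (`48 d`). Between some two consecutive breadth-first
layers half of that density survives (`24 d`), and deleting vertices of low degree leaves a
bipartite graph `F` of minimum degree above `12 d`.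

Pósa rotations in `F` (`exists_cycle_of_rotations`) give a set `S` such that `W ⊇ S ∪ N(S)` lies on
one cycle and `|W| ≤ 3|S|`. The set `W` spans more than `12 d |S| ≥ 4 d |W|` ordered adjacent pairs.
But averaging over `k`-subsets shows that at most `2k + 1` vertices of a bipartite `C_ℓ`-free graph
span at most `4 d` pairs per vertex (`pairCount_le`). So the cycle has at least `2k + 2` vertices,
and a vertex of `S`, having three neighbours on it, provides a chord.

Every second vertex of this cycle lies in the lower layer. Sort these vertices by the branch of the
breadth-first tree below their last common ancestor. By `IsCyclicSeq.exists_crossing_path` two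
different branches are joined by paths of every even length shorter than the cycle. Closing each
path through the tree costs the same number of edges each time, so the cycles have consecutive even
lengths.

For residues, `k` consecutive even lengths meet every class modulo `k` that contains an even number.
For the lower bound, on `k` vertices the only possible cycle length congruent to `ℓ` is `ℓ` itself,
so an extremal graph for `d` has no such cycle. -/

namespace CycleLengths

/-! ### Gluing paths and closing them to cycles. -/

section Walks

variable {V : Type*} {G : SimpleGraph V}

/-- There is a path from `a` to `b` with `n` edges whose vertices all lie in `s`. -/
def PathIn (G : SimpleGraph V) (s : Set V) (a b : V) (n : ℕ) : Prop :=
  ∃ p : G.Walk a b, p.IsPath ∧ p.length = n ∧ ∀ x ∈ p.support, x ∈ s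

theorem PathIn.refl {s : Set V} {a : V} (ha : a ∈ s) : PathIn G s a a 0 :=
  ⟨.nil, by simp, rfl, by simpa using ha⟩

theorem PathIn.symm {s : Set V} {a b : V} {n : ℕ} (h : PathIn G s a b n) : PathIn G s b a n := by
  obtain ⟨p, hp, hl, hs⟩ := h
  exact ⟨p.reverse, hp.reverse, by simpa using hl, by simpa using hs⟩

theorem PathIn.mono {G' : SimpleGraph V} {s t : Set V} {a b : V} {n : ℕ} (hG : G ≤ G')
    (hst : s ⊆ t) (h : PathIn G s a b n) : PathIn G' t a b n := by
  obtain ⟨p, hp, hl, hs⟩ := h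
  refine ⟨p.mapLe hG, hp.mapLe hG, by simpa using hl, fun x hx => hst (hs x ?_)⟩
  simpa using hx

theorem PathIn.join {s t : Set V} {a b c d : V} {m n : ℕ} (h₁ : PathIn G s a b m)
    (hbc : G.Adj b c) (h₂ : PathIn G t c d n) (hst : Disjoint s t) :
    PathIn G (s ∪ t) a d (m + 1 + n) := by
  obtain ⟨p, hp, hpl, hps⟩ := h₁
  obtain ⟨q, hq, hql, hqs⟩ := h₂
  refine ⟨p.append (.cons hbc q), ?_, by simp [hpl, hql]; ring, ?_⟩
  · rw [SimpleGraph.Walk.isPath_def, SimpleGraph.Walk.support_append, List.nodup_append']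
    refine ⟨hp.support_nodup, by simpa using hq.support_nodup, fun x hx hx' => ?_⟩
    exact Set.disjoint_left.1 hst (hps x hx) (hqs x (by simpa using hx'))
  · intro x hx
    rw [SimpleGraph.Walk.support_append, List.mem_append] at hx
    rcases hx with hx | hx
    · exact .inl (hps x hx)
    · exact .inr (hqs x (by simpa using hx))

theorem PathIn.hasCycle {s : Set V} {u v : V} {n : ℕ} (h : PathIn G s u v n) (hn : 2 ≤ n)
    (hvu : G.Adj v u) : HasCycle G (n + 1) := by
  obtain ⟨p, hp, hl, -⟩ := h
  refine ⟨v, .cons hvu p, ?_, by simp [hl]⟩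
  rw [SimpleGraph.Walk.cons_isCycle_iff]
  refine ⟨hp, fun hmem => ?_⟩
  -- A path containing an edge between its own ends is that edge alone.
  have := hp.length_eq_one_of_mem_edges (Sym2.eq_swap ▸ hmem)
  omega

theorem HasCycle.exists_path {n : ℕ} (h : HasCycle G n) :
    3 ≤ n ∧ ∃ (u v : V) (p : G.Walk u v), p.IsPath ∧ p.length + 1 = n ∧ G.Adj v u := by
  obtain ⟨v, p, hp, rfl⟩ := h
  refine ⟨hp.three_le_length, ?_⟩
  cases p with
  | nil => exact absurd rfl hp.ne_nil
  | cons h q => exact ⟨_, _, q, ((SimpleGraph.Walk.cons_isCycle_iff q h).1 hp).1, by simp, h⟩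

theorem HasCycle.mono {G' : SimpleGraph V} (hG : G ≤ G') {n : ℕ} (h : HasCycle G n) :
    HasCycle G' n := by
  obtain ⟨v, p, hp, hl⟩ := h
  exact ⟨v, p.mapLe hG, hp.mapLe hG, by simpa using hl⟩

/-- A cycle stays in one component, so injectivity on components suffices. This allows the
projection of disjoint copies onto a single one. -/
theorem HasCycle.map {V' : Type*} {G' : SimpleGraph V'} (f : G →g G')
    (hf : ∀ u v, G.Reachable u v → f u = f v → u = v) {n : ℕ} (h : HasCycle G n) :
    HasCycle G' n := by
  obtain ⟨hn, u, v, p, hp, hl, hvu⟩ := h.exists_path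
  have hpath : PathIn G' Set.univ (f u) (f v) p.length := by
    refine ⟨p.map f, ?_, by simp, by simp⟩
    rw [SimpleGraph.Walk.isPath_def, SimpleGraph.Walk.support_map]
    refine hp.support_nodup.map_on fun x hx y hy hxy => hf x y ?_ hxy
    classical
    exact (p.takeUntil x hx).reachable.symm.trans (p.takeUntil y hy).reachable
  rw [← hl]
  exact hpath.hasCycle (by omega) (f.map_adj hvu)

theorem HasCycle.le_card [Fintype V] {n : ℕ} (h : HasCycle G n) : n ≤ Fintype.card V := by
  obtain ⟨-, u, v, p, hp, rfl, -⟩ := h.exists_path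
  exact hp.length_lt

end Walks

/-! ### Sparsity of small sets in bipartite `C_ℓ`-free graphs. -/

section PairCount

variable {V : Type*}

open Classical in
/-- The number of ordered pairs of adjacent vertices in `U`. -/
noncomputable def pairCount (G : SimpleGraph V) (U : Finset V) : ℝ :=
  ∑ u ∈ U, ∑ v ∈ U, if G.Adj u v then 1 else 0

theorem pairCount_univ [Fintype V] (G : SimpleGraph V) :
    pairCount G Finset.univ = avgDegree G * Fintype.card V := by
  classical
  rcases isEmpty_or_nonempty V with hV | hV
  · simp [pairCount]
  have : (Fintype.card V : ℝ) ≠ 0 := by exact_mod_cast Fintype.card_ne_zero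
  rw [avgDegree, div_mul_cancel₀ _ this, pairCount]
  refine Finset.sum_congr rfl fun u _ => ?_
  rw [Finset.sum_boole, SimpleGraph.degree, SimpleGraph.neighborFinset_eq_filter]

theorem pairCount_map {V' : Type*} (G : SimpleGraph V) (e : V' ↪ V) (U : Finset V') :
    pairCount G (U.map e) = pairCount (G.comap e) U := by
  simp only [pairCount, Finset.sum_map]
  rfl

theorem IsBipartite.comap {V' : Type*} {G : SimpleGraph V} (h : G.IsBipartite) (f : V' → V) :
    (G.comap f).IsBipartite :=
  SimpleGraph.Colorable.of_hom (SimpleGraph.Hom.comap f G) h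

theorem not_hasCycle_comap {V' : Type*} {G : SimpleGraph V} {f : V' → V}
    (hf : Function.Injective f) {n : ℕ} (h : ¬ HasCycle G n) : ¬ HasCycle (G.comap f) n :=
  fun h' => h (h'.map (SimpleGraph.Hom.comap f G) fun _ _ _ e => hf e)

theorem pairCount_le_of_card_eq {k ℓ : ℕ} {G : SimpleGraph V} (hG : G.IsBipartite)
    (hc : ¬ HasCycle G ℓ) {K : Finset V} (hK : K.card = k) : pairCount G K ≤ maxDeg k ℓ * k := by
  let e : Fin k ↪ V :=
    (Finset.equivFinOfCardEq hK).symm.toEmbedding.trans (Function.Embedding.subtype _)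
  have hmap : Finset.univ.map e = K := by
    ext x
    simp only [Finset.mem_map, Finset.mem_univ, true_and]
    constructor
    · rintro ⟨i, rfl⟩
      exact ((Finset.equivFinOfCardEq hK).symm i).2
    · intro hx
      exact ⟨Finset.equivFinOfCardEq hK ⟨x, hx⟩, by simp [e]⟩
  rw [← hmap, pairCount_map, pairCount_univ, Fintype.card_fin]
  refine mul_le_mul_of_nonneg_right ?_ (Nat.cast_nonneg _)
  exact (isGreatest_maxDeg k).2 ⟨_, IsBipartite.comap hG e, not_hasCycle_comap e.injective hc, rfl⟩

theorem choose_identity (n j : ℕ) :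
    (n + 2) * (n + 1) * n.choose j = (n + 2).choose (j + 2) * ((j + 2) * (j + 1)) := by
  have h₁ := Nat.add_one_mul_choose_eq n j
  have h₂ := Nat.add_one_mul_choose_eq (n + 1) (j + 1)
  rw [mul_assoc, h₁, ← mul_assoc, show n + 2 = n + 1 + 1 from rfl, h₂]
  ring

/-- Double counting: a pair of distinct vertices lies in `n.choose j` of the `(j + 2)`-subsets of an
`(n + 2)`-set. -/
theorem sum_pairCount_powersetCard [Fintype V] (G : SimpleGraph V) {n j : ℕ}
    (hn : Fintype.card V = n + 2) :
    ∑ K ∈ Finset.powersetCard (j + 2) (Finset.univ : Finset V), pairCount G K =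
      n.choose j * pairCount G Finset.univ := by
  classical
  have key : ∀ K : Finset V, pairCount G K =
      ∑ u : V, ∑ v : V, if G.Adj u v then (if {u, v} ⊆ K then (1 : ℝ) else 0) else 0 := by
    intro K
    rw [pairCount, ← Finset.sum_subset (Finset.subset_univ K)]
    · refine Finset.sum_congr rfl fun u hu => ?_
      rw [← Finset.sum_subset (Finset.subset_univ K)]
      · refine Finset.sum_congr rfl fun v hv => ?_
        have : ({u, v} : Finset V) ⊆ K := by
          intro x hx
          rcases Finset.mem_insert.1 hx with rfl | hx
          · exact hu
          · exact (Finset.mem_singleton.1 hx) ▸ hv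
        simp [this]
      · intro v _ hv
        simp [Finset.insert_subset_iff, hv]
    · intro u _ hu
      simp [Finset.insert_subset_iff, hu]
  rw [Finset.sum_congr rfl fun K _ => key K, pairCount]
  rw [Finset.sum_comm, Finset.mul_sum]
  refine Finset.sum_congr rfl fun u _ => ?_
  rw [Finset.sum_comm, Finset.mul_sum]
  refine Finset.sum_congr rfl fun v _ => ?_
  by_cases huv : G.Adj u v
  · simp only [huv, if_true, mul_one]
    rw [Finset.sum_boole, Finset.card_filter_powersetCard_subset _ _ _ (Finset.subset_univ _)]
    · rw [Finset.card_pair huv.ne, Finset.card_univ, hn]; simp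
    · rw [Finset.card_pair huv.ne]; omega
  · simp [huv]

theorem pairCount_mul_le_of_le_card [Fintype V] {k ℓ : ℕ} {G : SimpleGraph V}
    (hG : G.IsBipartite) (hc : ¬ HasCycle G ℓ) (hk : 2 ≤ k) (hkn : k ≤ Fintype.card V) :
    pairCount G Finset.univ * (k - 1) ≤
      maxDeg k ℓ * (Fintype.card V * (Fintype.card V - 1)) := by
  obtain ⟨j, rfl⟩ := Nat.exists_eq_add_of_le' hk
  obtain ⟨n, hn⟩ := Nat.exists_eq_add_of_le' (hk.trans hkn)
  have hsum := sum_pairCount_powersetCard (j := j) G hn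
  have hle : ∑ K ∈ Finset.powersetCard (j + 2) (Finset.univ : Finset V), pairCount G K ≤
      ((n + 2).choose (j + 2) : ℝ) * (maxDeg (j + 2) ℓ * (j + 2 : ℕ)) := by
    refine (Finset.sum_le_card_nsmul _ _ _ fun K hK =>
      pairCount_le_of_card_eq hG hc (Finset.mem_powersetCard.1 hK).2).trans ?_
    rw [Finset.card_powersetCard, Finset.card_univ, hn, nsmul_eq_mul]
  rw [hsum] at hle
  have hid : ((n : ℝ) + 2) * (n + 1) * n.choose j =
      (n + 2).choose (j + 2) * ((j + 2) * (j + 1)) := by exact_mod_cast choose_identity n j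
  have hpos : (0 : ℝ) < n.choose j := by
    exact_mod_cast Nat.choose_pos (by omega)
  rw [hn]
  push_cast at hle ⊢
  refine le_of_mul_le_mul_left ?_ hpos
  calc (n.choose j : ℝ) * (pairCount G Finset.univ * ((j : ℝ) + 2 - 1))
      = (n.choose j * pairCount G Finset.univ) * (j + 1) := by ring
    _ ≤ ((n + 2).choose (j + 2) * (maxDeg (j + 2) ℓ * (j + 2))) * (j + 1) :=
        mul_le_mul_of_nonneg_right hle (by positivity)
    _ = maxDeg (j + 2) ℓ * ((n + 2).choose (j + 2) * ((j + 2) * (j + 1))) := by ring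
    _ = _ := by rw [← hid]; ring

/-- The disjoint union of copies of `G` indexed by `ι`. -/
def copies (ι : Type*) (G : SimpleGraph V) : SimpleGraph (ι × V) where
  Adj x y := x.1 = y.1 ∧ G.Adj x.2 y.2
  symm := ⟨fun _ _ h => ⟨h.1.symm, h.2.symm⟩⟩
  loopless := ⟨fun _ h => G.loopless.irrefl _ h.2⟩

theorem copies_fst_eq {ι : Type*} {G : SimpleGraph V} {x y : ι × V}
    (h : (copies ι G).Reachable x y) : x.1 = y.1 := by
  obtain ⟨p⟩ := h
  induction p with
  | nil => rfl
  | cons h _ ih => exact h.1.trans ih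

/-- The projection of the copies of `G` onto `G`. -/
def copiesHom (ι : Type*) (G : SimpleGraph V) : copies ι G →g G := ⟨Prod.snd, fun h => h.2⟩

theorem pairCount_copies {ι : Type*} [Fintype ι] [Fintype V] (G : SimpleGraph V) :
    pairCount (copies ι G) Finset.univ = Fintype.card ι * pairCount G Finset.univ := by
  classical
  simp only [pairCount, Fintype.sum_prod_type, copies]
  rw [← nsmul_eq_mul, ← Finset.card_univ, ← Finset.sum_const]
  refine Finset.sum_congr rfl fun i _ => Finset.sum_congr rfl fun u _ => ?_
  rw [Finset.sum_eq_single i]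
  · simp
  · intro j _ hj
    simp [hj.symm]
  · simp

theorem maxDeg_nonneg (k ℓ : ℕ) : 0 ≤ maxDeg k ℓ := by
  obtain ⟨G, -, -, h⟩ := (isGreatest_maxDeg k (ℓ := ℓ)).1
  rw [← h, avgDegree]
  positivity

/-- The averaging bound needs at least `k` vertices; a smaller graph is replaced by disjoint copies,
which change neither the density nor the cycle lengths. -/
theorem pairCount_univ_le [Fintype V] {k ℓ : ℕ} {G : SimpleGraph V} (hG : G.IsBipartite)
    (hc : ¬ HasCycle G ℓ) (hk : 2 ≤ k) (hcard : Fintype.card V ≤ 2 * k + 1) :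
    pairCount G Finset.univ ≤ 4 * maxDeg k ℓ * Fintype.card V := by
  rcases isEmpty_or_nonempty V with hV | hV
  · simp [pairCount]
  have hw : 0 < Fintype.card V := Fintype.card_pos
  set w := Fintype.card V
  -- The upper bound says `q * w - 1 ≤ 4 * (k - 1)`, the source of the factor 4. For `q = 1` it
  -- follows from `w ≤ 2k + 1` and `k ≥ 2`.
  obtain ⟨q, hq, hkq, hqw⟩ : ∃ q : ℕ, 0 < q ∧ k ≤ q * w ∧ q * w ≤ 4 * k - 3 := by
    rcases le_or_gt k w with h | h
    · exact ⟨1, one_pos, by omega, by omega⟩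
    · refine ⟨k / w + 1, Nat.succ_pos _, ?_, ?_⟩
      · rw [add_mul, one_mul]
        exact (Nat.lt_div_mul_add hw).le
      · have := Nat.div_mul_le_self k w
        rw [add_mul, one_mul]
        generalize k / w * w = x at this
        omega
  have h := pairCount_mul_le_of_le_card (k := k) (ℓ := ℓ) (G := copies (Fin q) G)
    (SimpleGraph.Colorable.of_hom (copiesHom (Fin q) G) hG)
    (fun h' => hc (h'.map (copiesHom (Fin q) G) fun x y hxy e => Prod.ext (copies_fst_eq hxy) e))
    hk (by simpa using hkq)
  rw [pairCount_copies, Fintype.card_prod, Fintype.card_fin] at h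
  have hqR : (0 : ℝ) < q := by exact_mod_cast hq
  have hkR : (2 : ℝ) ≤ k := by exact_mod_cast hk
  have hle : ((q * w : ℕ) : ℝ) - 1 ≤ 4 * (k - 1) := by
    have : q * w + 3 ≤ 4 * k := by omega
    have : ((q * w : ℕ) : ℝ) + 3 ≤ 4 * k := by exact_mod_cast this
    linarith
  have hd := maxDeg_nonneg k ℓ
  refine le_of_mul_le_mul_left ?_ (mul_pos hqR (by linarith : (0 : ℝ) < k - 1))
  calc (q : ℝ) * (k - 1) * pairCount G Finset.univ
      = q * pairCount G Finset.univ * (k - 1) := by ring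
    _ ≤ maxDeg k ℓ * ((q * w : ℕ) * ((q * w : ℕ) - 1)) := h
    _ ≤ maxDeg k ℓ * ((q * w : ℕ) * (4 * (k - 1))) := by gcongr
    _ = _ := by push_cast; ring

/-- A bipartite graph without cycles of length `ℓ` is sparse on sets of at most `2k + 1`
vertices. -/
theorem pairCount_le {k ℓ : ℕ} {G : SimpleGraph V} (hG : G.IsBipartite)
    (hc : ¬ HasCycle G ℓ) (hk : 2 ≤ k) {U : Finset V} (hU : U.card ≤ 2 * k + 1) :
    pairCount G U ≤ 4 * maxDeg k ℓ * U.card := by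
  have h := pairCount_univ_le (V := U) (k := k) (IsBipartite.comap hG Subtype.val)
    (not_hasCycle_comap Subtype.val_injective hc) hk (by simpa using hU)
  have hmap : (Finset.univ : Finset U).map (Function.Embedding.subtype _) = U := by
    ext; simp
  have h' := pairCount_map G (Function.Embedding.subtype (· ∈ U)) Finset.univ
  rw [hmap] at h'
  rw [h']
  simpa using h

/-- A tree on `k` vertices has average degree `2(k - 1)/k ≥ 1`. -/
theorem one_le_maxDeg {k ℓ : ℕ} (hk : 2 ≤ k) : 1 ≤ maxDeg k ℓ := by
  classical
  have : Nonempty (Fin k) := ⟨⟨0, by omega⟩⟩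
  obtain ⟨T, -, hT⟩ := (SimpleGraph.connected_top (V := Fin k)).exists_isTree_le
  have hmem : avgDegree T ∈ bipartiteFreeAvgDegrees k ℓ :=
    ⟨T, hT.isBipartite, fun ⟨v, p, hp, _⟩ => hT.isAcyclic p hp, rfl⟩
  refine le_trans ?_ ((isGreatest_maxDeg k).2 hmem)
  have hE := hT.card_edgeFinset
  have hS := T.sum_degrees_eq_twice_card_edges
  have hS' : ∑ v, (T.degree v : ℝ) = 2 * (k - 1 : ℝ) := by
    rw [← Nat.cast_sum, hS]
    rw [Fintype.card_fin] at hE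
    have : (T.edgeFinset.card : ℝ) + 1 = k := by exact_mod_cast hE
    push_cast
    linarith
  have hkR : (2 : ℝ) ≤ k := by exact_mod_cast hk
  rw [avgDegree, Fintype.card_fin, le_div_iff₀ (by linarith)]
  refine le_trans (b := ∑ v, (T.degree v : ℝ)) ?_ (Finset.sum_le_sum fun v _ => ?_)
  · rw [hS']; linarith
  · exact le_of_eq (by congr!)

end PairCount

/-! ### Passing to a dense bipartite graph between two breadth-first layers. -/

section Reduction

variable {V : Type*}

/-- The edges of `G` whose ends get different colours. -/
def cutGraph (G : SimpleGraph V) (f : V → Bool) : SimpleGraph V where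
  Adj u v := G.Adj u v ∧ f u ≠ f v
  symm := ⟨fun _ _ h => ⟨h.1.symm, h.2.symm⟩⟩
  loopless := ⟨fun _ h => h.2 rfl⟩

/-- Flipping the colour of `u` exchanges the colourings that separate `u` and `v` with the others.
-/
theorem card_separating_functions [Fintype V] [DecidableEq V] {u v : V} (huv : u ≠ v) :
    2 * (Finset.univ.filter fun f : V → Bool => f u ≠ f v).card =
      Fintype.card (V → Bool) := by
  have : (Finset.univ.filter fun f : V → Bool => f u ≠ f v).card =
      (Finset.univ.filter fun f : V → Bool => ¬ f u ≠ f v).card := by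
    refine Finset.card_bij' (fun f _ => Function.update f u (!f u))
      (fun f _ => Function.update f u (!f u)) ?_ ?_ ?_ ?_
    · intro f; cases h₁ : f u <;> cases h₂ : f v <;> simp [Function.update_of_ne huv.symm, h₁, h₂]
    · intro f; cases h₁ : f u <;> cases h₂ : f v <;> simp [Function.update_of_ne huv.symm, h₁, h₂]
    · intro f _; simp
    · intro f _; simp
  rw [two_mul]
  nth_rw 2 [this]
  rw [Finset.card_filter_add_card_filter_not, Finset.card_univ]

theorem exists_pairCount_le_two_mul_cutGraph [Fintype V] (G : SimpleGraph V) :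
    ∃ f : V → Bool, pairCount G Finset.univ ≤ 2 * pairCount (cutGraph G f) Finset.univ := by
  classical
  have hcut : ∀ f u v, (if (cutGraph G f).Adj u v then (1 : ℝ) else 0) =
      if G.Adj u v then (if f u ≠ f v then 1 else 0) else 0 := by
    intro f u v
    by_cases h₁ : G.Adj u v <;> by_cases h₂ : f u = f v <;> simp [cutGraph, h₁, h₂]
  have hcomm : ∀ g : (V → Bool) → V → V → ℝ,
      ∑ f, ∑ u, ∑ v, g f u v = ∑ u, ∑ v, ∑ f, g f u v := fun g =>
    Finset.sum_comm.trans (Finset.sum_congr rfl fun u _ => Finset.sum_comm)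
  have hsum : ∑ f : V → Bool, pairCount G Finset.univ =
      ∑ f : V → Bool, 2 * pairCount (cutGraph G f) Finset.univ := by
    simp only [pairCount, hcut]
    rw [← Finset.mul_sum, hcomm, hcomm, Finset.mul_sum]
    refine Finset.sum_congr rfl fun u _ => ?_
    rw [Finset.mul_sum]
    refine Finset.sum_congr rfl fun v _ => ?_
    by_cases huv : G.Adj u v
    · simp only [huv, if_true]
      rw [Finset.sum_boole, Finset.sum_const, Finset.card_univ,
        ← card_separating_functions huv.ne]
      simp
    · simp [huv]
  obtain ⟨f, -, hf⟩ := Finset.exists_le_of_sum_le Finset.univ_nonempty hsum.le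
  exact ⟨f, hf⟩

/-- The edges of `G` between the layers `i` and `i + 1` of `h`. -/
def layerGraph (G : SimpleGraph V) (h : V → ℕ) (i : ℕ) : SimpleGraph V where
  Adj u v := G.Adj u v ∧ (h u = i ∧ h v = i + 1 ∨ h u = i + 1 ∧ h v = i)
  symm := ⟨fun _ _ h => ⟨h.1.symm, h.2.symm.imp And.symm And.symm⟩⟩
  loopless := ⟨fun _ h => G.loopless.irrefl _ h.1⟩

/-- Each edge lies in exactly one pair of consecutive layers and each vertex in at most two such
pairs, so some pair keeps half of the density. -/
theorem exists_dense_layerGraph [Fintype V] [Nonempty V] {G : SimpleGraph V} {h : V → ℕ}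
    (hh : ∀ u v, G.Adj u v → h v = h u + 1 ∨ h u = h v + 1) {c : ℝ} (hc : 0 ≤ c)
    (hG : 2 * c * Fintype.card V ≤ pairCount G Finset.univ) :
    ∃ i, ∃ U : Finset V, U.Nonempty ∧ c * U.card ≤ pairCount (layerGraph G h i) U := by
  classical
  let U : ℕ → Finset V := fun i => Finset.univ.filter fun v => h v = i ∨ h v = i + 1
  let I : Finset ℕ := Finset.univ.image h
  have hcount : ∀ i, pairCount (layerGraph G h i) (U i) =
      ∑ u : V, ∑ v : V, if (layerGraph G h i).Adj u v then (1 : ℝ) else 0 := by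
    intro i
    rw [pairCount, ← Finset.sum_subset (Finset.subset_univ (U i))]
    · refine Finset.sum_congr rfl fun u hu => Finset.sum_subset (Finset.subset_univ (U i)) ?_
      intro v _ hv
      refine if_neg fun hadj => hv ?_
      simp only [U, Finset.mem_filter, Finset.mem_univ, true_and]
      exact hadj.2.elim (fun h => .inr h.2) (fun h => .inl h.2)
    · intro u _ hu
      refine Finset.sum_eq_zero fun v _ => if_neg fun hadj => hu ?_
      simp only [U, Finset.mem_filter, Finset.mem_univ, true_and]
      exact hadj.2.elim (fun h => .inl h.1) (fun h => .inr h.1)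
  have hedges : pairCount G Finset.univ = ∑ i ∈ I, pairCount (layerGraph G h i) (U i) := by
    simp_rw [hcount]
    rw [Finset.sum_comm, pairCount]
    refine Finset.sum_congr rfl fun u _ => ?_
    rw [Finset.sum_comm]
    refine Finset.sum_congr rfl fun v _ => ?_
    by_cases huv : G.Adj u v
    · rw [if_pos huv, Finset.sum_eq_single (min (h u) (h v)), if_pos]
      · refine ⟨huv, ?_⟩
        rcases hh u v huv with h' | h' <;> omega
      · intro i _ hi
        refine if_neg fun hadj => hi ?_
        rcases hadj.2 with h' | h' <;> omega
      · intro hI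
        refine absurd ?_ hI
        rcases min_choice (h u) (h v) with h' | h' <;> rw [h'] <;>
          exact Finset.mem_image_of_mem _ (Finset.mem_univ _)
    · rw [if_neg huv, Finset.sum_eq_zero]
      exact fun i _ => if_neg fun hadj => huv hadj.1
  have hsize : ∑ i ∈ I, (U i).card ≤ 2 * Fintype.card V := by
    have : ∀ i, (U i).card ≤ ∑ v : V, if h v = i ∨ h v = i + 1 then 1 else 0 := by
      intro i; simp [U]
    refine (Finset.sum_le_sum fun i _ => this i).trans ?_
    rw [Finset.sum_comm, mul_comm, ← smul_eq_mul, ← Finset.card_univ, ← Finset.sum_const]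
    refine Finset.sum_le_sum fun v _ => ?_
    rw [← Finset.card_filter]
    refine (Finset.card_le_card (t := {h v, h v - 1}) fun i hi => ?_).trans Finset.card_le_two
    have := (Finset.mem_filter.1 hi).2
    simp only [Finset.mem_insert, Finset.mem_singleton]
    omega
  have hI : I.Nonempty := Finset.univ_nonempty.image h
  have hle : ∑ i ∈ I, c * ((U i).card : ℝ) ≤ ∑ i ∈ I, pairCount (layerGraph G h i) (U i) := by
    rw [← hedges, ← Finset.mul_sum, ← Nat.cast_sum]
    refine le_trans ?_ hG
    have : ((∑ i ∈ I, (U i).card : ℕ) : ℝ) ≤ 2 * Fintype.card V := by exact_mod_cast hsize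
    nlinarith
  obtain ⟨i, hi, hle⟩ := Finset.exists_le_of_sum_le hI hle
  refine ⟨i, U i, ?_, hle⟩
  obtain ⟨v, -, rfl⟩ := Finset.mem_image.1 hi
  exact ⟨v, by simp [U]⟩

open Classical in
theorem pairCount_erase (G : SimpleGraph V) {U : Finset V} {u : V} (hu : u ∈ U) :
    pairCount G U = pairCount G (U.erase u) + 2 * (U.filter fun v => G.Adj u v).card := by
  have hdeg : (∑ v ∈ U, if G.Adj u v then (1 : ℝ) else 0) =
      (U.filter fun v => G.Adj u v).card := by
    rw [Finset.sum_boole]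
  have hdeg' : (∑ v ∈ U.erase u, if G.Adj v u then (1 : ℝ) else 0) =
      (U.filter fun v => G.Adj u v).card := by
    rw [← hdeg, ← Finset.add_sum_erase U _ hu]
    simp [G.adj_comm]
  rw [pairCount, ← Finset.add_sum_erase U _ hu, hdeg, pairCount]
  have : ∀ v ∈ U.erase u, (∑ w ∈ U, if G.Adj v w then (1 : ℝ) else 0) =
      (if G.Adj v u then 1 else 0) + ∑ w ∈ U.erase u, if G.Adj v w then 1 else 0 :=
    fun v _ => (Finset.add_sum_erase U _ hu).symm
  rw [Finset.sum_congr rfl this, Finset.sum_add_distrib, hdeg']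
  ring

-- Deleting a vertex of degree at most `c` removes at most `2c` ordered pairs, so the density
-- hypothesis persists until no such vertex remains.
open Classical in
theorem exists_subset_min_degree (G : SimpleGraph V) {c : ℝ} (hc : 0 < c) (U : Finset V)
    (hU : U.Nonempty) (hd : 2 * c * U.card ≤ pairCount G U) :
    ∃ U' : Finset V, U'.Nonempty ∧ ∀ u ∈ U', c < (U'.filter fun v => G.Adj u v).card := by
  induction U using Finset.strongInduction with
  | H U ih =>
    by_cases hall : ∀ u ∈ U, c < (U.filter fun v => G.Adj u v).card
    · exact ⟨U, hU, hall⟩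
    push Not at hall
    obtain ⟨u, hu, hle⟩ := hall
    have hpc := pairCount_erase G hu
    have hcard : ((U.erase u).card : ℝ) = U.card - 1 := by
      rw [Finset.card_erase_of_mem hu, Nat.cast_sub hU.card_pos, Nat.cast_one]
    refine ih _ (Finset.erase_ssubset hu) ?_ (by rw [hcard]; linarith)
    rw [Finset.nonempty_iff_ne_empty]
    intro hempty
    have hUu : U = {u} := by
      rw [← Finset.insert_erase hu, hempty]; rfl
    subst hUu
    simp [pairCount] at hd
    linarith

/-- The subgraph of the edges of `G` with both ends in `U`. -/
def restrictTo (G : SimpleGraph V) (U : Finset V) : SimpleGraph V where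
  Adj u v := G.Adj u v ∧ u ∈ U ∧ v ∈ U
  symm := ⟨fun _ _ h => ⟨h.1.symm, h.2.2, h.2.1⟩⟩
  loopless := ⟨fun _ h => G.loopless.irrefl _ h.1⟩

/-- A bipartite graph has a breadth-first layering `h` with a parent function `π`. -/
theorem exists_layering {G : SimpleGraph V} (f : V → Bool) (hf : ∀ u v, G.Adj u v → f u ≠ f v) :
    ∃ (h : V → ℕ) (π : V → V), (∀ u v, G.Adj u v → h v = h u + 1 ∨ h u = h v + 1) ∧
      (∀ v, h v ≠ 0 → G.Adj v (π v) ∧ h (π v) + 1 = h v) ∧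
      (∀ u v, h u = 0 → h v = 0 → G.Reachable u v → u = v) := by
  classical
  let r : V → V := fun v => (G.connectedComponentMk v).out
  have hr : ∀ v, G.Reachable (r v) v := fun v =>
    SimpleGraph.ConnectedComponent.exact (Quot.out_eq (G.connectedComponentMk v))
  have hr' : ∀ u v, G.Reachable u v → r u = r v := fun u v huv => by
    simp only [r]; rw [SimpleGraph.ConnectedComponent.sound huv]
  -- The parity of the distance from the root is determined by the colour, so no edge stays inside a
  -- layer.
  have hparity : ∀ u v, G.Adj u v → G.dist (r v) v ≠ G.dist (r u) u := by
    intro u v huv heq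
    obtain ⟨p, hp⟩ := (hr u).exists_walk_length_eq_dist
    obtain ⟨q, hq⟩ := (hr v).exists_walk_length_eq_dist
    let C : G.Coloring Bool := SimpleGraph.Coloring.mk f fun {a b} h => hf a b h
    have h₁ := C.even_length_iff_congr p
    have h₂ := C.even_length_iff_congr q
    rw [hp, ← heq, ← hq, h₂, hr' u v huv.reachable] at h₁
    have h₃ : f u ≠ f v := hf u v huv
    change (f (r v) ↔ f v) ↔ (f (r v) ↔ f u) at h₁
    revert h₁ h₃
    cases f (r v) <;> cases f u <;> cases f v <;> simp
  have hparent : ∀ v, ∃ w, G.dist (r v) v ≠ 0 →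
      G.Adj v w ∧ G.dist (r w) w + 1 = G.dist (r v) v := by
    intro v
    by_cases h0 : G.dist (r v) v = 0
    · exact ⟨v, fun h => absurd h0 h⟩
    obtain ⟨p, hp⟩ := (hr v).symm.exists_walk_length_eq_dist
    rw [SimpleGraph.dist_comm] at hp
    have hne : v ≠ r v := fun h => h0 (by rw [← h, SimpleGraph.dist_self])
    obtain ⟨w, hvw, q, rfl⟩ := p.exists_eq_cons_of_ne hne
    refine ⟨w, fun _ => ⟨hvw, ?_⟩⟩
    have hrw := hr' v w hvw.reachable
    have h₁ : G.dist (r w) w ≤ q.length := by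
      rw [SimpleGraph.dist_comm, ← hrw]; exact SimpleGraph.dist_le q
    obtain ⟨s, hs⟩ := (hr w).exists_walk_length_eq_dist
    have h₂ : G.dist (r v) v ≤ G.dist (r w) w + 1 := by
      rw [← hs, hrw]
      simpa using SimpleGraph.dist_le (s.concat hvw.symm)
    simp only [SimpleGraph.Walk.length_cons] at hp
    omega
  choose π hπ using hparent
  refine ⟨fun v => G.dist (r v) v, π, ?_, hπ, ?_⟩
  · intro u v huv
    have h₁ := hparity u v huv
    have hle : ∀ u v, G.Adj u v → G.dist (r v) v ≤ G.dist (r u) u + 1 := by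
      intro u v huv
      obtain ⟨s, hs⟩ := (hr u).exists_walk_length_eq_dist
      rw [← hs, ← hr' u v huv.reachable]
      simpa using SimpleGraph.dist_le (s.concat huv)
    have h₂ := hle u v huv
    have h₃ := hle v u huv.symm
    simp only
    omega
  · intro u v hu hv huv
    rw [(hr u).dist_eq_zero_iff] at hu
    rw [(hr v).dist_eq_zero_iff] at hv
    rw [← hu, ← hv, hr' u v huv]

end Reduction

/-! ### Pósa rotations of a longest path. -/

section Rotation

variable {V : Type*}

/-- `z` is immediately followed by `w` in the list `l`. -/
def FollowedBy (l : List V) (z w : V) : Prop := ∃ s t, l = s ++ z :: w :: t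

theorem followedBy_cons {x : V} {l : List V} {z w : V} :
    FollowedBy (x :: l) z w ↔ x = z ∧ l.head? = some w ∨ FollowedBy l z w := by
  constructor
  · rintro ⟨s, t, h⟩
    cases s with
    | nil =>
      simp only [List.nil_append, List.cons.injEq] at h
      exact .inl ⟨h.1, by simp [h.2]⟩
    | cons y s =>
      simp only [List.cons_append, List.cons.injEq] at h
      exact .inr ⟨s, t, h.2⟩
  · rintro (⟨rfl, h⟩ | ⟨s, t, rfl⟩)
    · obtain ⟨t, rfl⟩ := List.head?_eq_some_iff.1 h
      exact ⟨[], t, rfl⟩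
    · exact ⟨x :: s, t, rfl⟩

theorem FollowedBy.reverse {l : List V} {z w : V} (h : FollowedBy l z w) :
    FollowedBy l.reverse w z := by
  obtain ⟨s, t, rfl⟩ := h
  exact ⟨t.reverse, s.reverse, by simp⟩

theorem FollowedBy.append {l₁ l₂ : List V} {z w : V} (h : FollowedBy (l₁ ++ l₂) z w) :
    FollowedBy l₁ z w ∨ FollowedBy l₂ z w ∨ l₁.getLast? = some z ∧ l₂.head? = some w := by
  induction l₁ with
  | nil => exact .inr (.inl h)
  | cons x l ih =>
    rw [List.cons_append, followedBy_cons] at h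
    rcases h with ⟨rfl, h⟩ | h
    · cases l with
      | nil => exact .inr (.inr ⟨rfl, h⟩)
      | cons y l => exact .inl (followedBy_cons.2 (.inl ⟨rfl, by simpa using h⟩))
    · rcases ih h with h | h | ⟨h₁, h₂⟩
      · exact .inl (followedBy_cons.2 (.inr h))
      · exact .inr (.inl h)
      · refine .inr (.inr ⟨?_, h₂⟩)
        rw [List.getLast?_cons, h₁]; rfl

theorem FollowedBy.append_left {l₁ : List V} (l₂ : List V) {z w : V} (h : FollowedBy l₁ z w) :
    FollowedBy (l₁ ++ l₂) z w := by
  obtain ⟨s, t, rfl⟩ := h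
  exact ⟨s, t ++ l₂, by simp⟩

theorem FollowedBy.append_right (l₁ : List V) {l₂ : List V} {z w : V} (h : FollowedBy l₂ z w) :
    FollowedBy (l₁ ++ l₂) z w := by
  obtain ⟨s, t, rfl⟩ := h
  exact ⟨l₁ ++ s, t, by simp⟩

theorem FollowedBy.unique {l : List V} (hl : l.Nodup) {z w w' : V} (h : FollowedBy l z w)
    (h' : FollowedBy l z w') : w = w' := by
  induction l with
  | nil => obtain ⟨s, t, h⟩ := h; simp at h
  | cons x l ih =>
    have hmem : ∀ {y}, FollowedBy l z y → z ∈ l := by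
      rintro y ⟨s, t, rfl⟩; simp
    have hx := (List.nodup_cons.1 hl).1
    rw [followedBy_cons] at h h'
    rcases h with ⟨rfl, h⟩ | h <;> rcases h' with ⟨h₁, h'⟩ | h'
    · simpa [h] using h'
    · exact absurd (hmem h') hx
    · exact absurd (h₁ ▸ hmem h) hx
    · exact ih (List.nodup_cons.1 hl).2 h h'

/-- `z` and `w` are consecutive in the list `l`, in some order. -/
def Neighbours (l : List V) (z w : V) : Prop := FollowedBy l z w ∨ FollowedBy l w z

theorem exists_finset_neighbours {l : List V} (hl : l.Nodup) (s : V) :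
    ∃ T : Finset V, s ∈ T ∧ T.card ≤ 3 ∧ ∀ z, Neighbours l z s → z ∈ T := by
  classical
  have hnext : ∃ x, ∀ z, FollowedBy l s z → z = x := by
    by_cases h : ∃ x, FollowedBy l s x
    · obtain ⟨x, hx⟩ := h
      exact ⟨x, fun z hz => hz.unique hl hx⟩
    · exact ⟨s, fun z hz => absurd ⟨z, hz⟩ h⟩
  have hprev : ∃ x, ∀ z, FollowedBy l z s → z = x := by
    by_cases h : ∃ x, FollowedBy l x s
    · obtain ⟨x, hx⟩ := h
      exact ⟨x, fun z hz => hz.reverse.unique (List.nodup_reverse.2 hl) hx.reverse⟩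
    · exact ⟨s, fun z hz => absurd ⟨z, hz⟩ h⟩
  obtain ⟨x, hx⟩ := hnext
  obtain ⟨y, hy⟩ := hprev
  refine ⟨{s, x, y}, by simp, Finset.card_le_three, ?_⟩
  rintro z (h | h)
  · simp [hy z h]
  · simp [hx z h]

variable {G : SimpleGraph V}

/-- `q'` arises from `q` by a rotation that moves the head. -/
def IsRotation (G : SimpleGraph V) (q q' : List V) : Prop :=
  ∃ u a z b, q = u :: a ++ z :: b ∧ G.Adj u z ∧ q' = (u :: a).reverse ++ z :: b

theorem IsRotation.perm {q q' : List V} (h : IsRotation G q q') : q'.Perm q := by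
  obtain ⟨u, a, z, b, rfl, -, rfl⟩ := h
  exact (List.reverse_perm _).append_right _

theorem IsRotation.isChain {q q' : List V} (h : IsRotation G q q') (hq : q.IsChain G.Adj) :
    q'.IsChain G.Adj := by
  obtain ⟨u, a, z, b, rfl, huz, rfl⟩ := h
  rw [List.isChain_append] at hq ⊢
  refine ⟨?_, hq.2.1, ?_⟩
  · rw [List.isChain_reverse]
    exact hq.1.imp fun _ _ h => h.symm
  · simpa using huz

theorem exists_longest_path [Finite V] (G : SimpleGraph V) {a b : V} (hab : G.Adj a b) :
    ∃ p : List V, p.Nodup ∧ p.IsChain G.Adj ∧ 2 ≤ p.length ∧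
      ∀ q : List V, q.Nodup → q.IsChain G.Adj → q.length ≤ p.length := by
  classical
  have := Fintype.ofFinite V
  let P : ℕ → Prop := fun n => ∃ p : List V, p.Nodup ∧ p.IsChain G.Adj ∧ p.length = n
  have hP : P 2 := ⟨[a, b], by simp [hab.ne], by simp [hab], rfl⟩
  have hb : ∀ n, P n → n ≤ Fintype.card V := by
    rintro n ⟨p, hp, -, rfl⟩
    exact hp.length_le_card
  obtain ⟨p, hp, hc, hl⟩ : P (Nat.findGreatest P (Fintype.card V)) :=
    Nat.findGreatest_spec (hb 2 hP) hP
  refine ⟨p, hp, hc, ?_, fun q hq hqc => ?_⟩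
  · rw [hl]; exact Nat.le_findGreatest (hb 2 hP) hP
  · have hPq : P q.length := ⟨q, hq, hqc, rfl⟩
    rw [hl]; exact Nat.le_findGreatest (hb _ hPq) hPq

theorem exists_last_mem {p : List V} {W : Finset V} (h : ∃ x ∈ p, x ∈ W) :
    ∃ a v b, p = a ++ v :: b ∧ v ∈ W ∧ ∀ x ∈ b, x ∉ W := by
  induction p with
  | nil => simp at h
  | cons y p ih =>
    by_cases h' : ∃ x ∈ p, x ∈ W
    · obtain ⟨a, v, b, rfl, hv, hb⟩ := ih h'
      exact ⟨y :: a, v, b, rfl, hv, hb⟩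
    · push Not at h'
      refine ⟨[], y, p, rfl, ?_, h'⟩
      obtain ⟨x, hx, hxW⟩ := h
      rcases List.mem_cons.1 hx with rfl | hx
      · exact hxW
      · exact absurd hxW (h' x hx)

/-- If the heads of all paths obtained from `p` by rotations lie in `S`, then an edge of such a
path at a vertex that is neither in `S` nor next to `S` on `p` is an edge of `p`. -/
theorem neighbours_of_rotations {p q : List V} {S : Set V}
    (hS : ∀ q, Relation.ReflTransGen (IsRotation G) p q → ∀ s ∈ q.head?, s ∈ S)
    (hq : Relation.ReflTransGen (IsRotation G) p q) {z : V} (hz : z ∉ S)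
    (hzp : ∀ s ∈ S, ¬ Neighbours p z s) {w : V} (h : Neighbours q z w) : Neighbours p z w := by
  induction hq generalizing w with
  | refl => exact h
  | @tail q q' hpq hqq' ih =>
    have hhead := hS q' (hpq.tail hqq')
    have hhead' := hS q hpq
    obtain ⟨u, a, y, b, rfl, huy, rfl⟩ := hqq'
    have hu : u ∈ S := hhead' u rfl
    obtain ⟨a', x, hax⟩ : ∃ a' x, u :: a = a' ++ [x] :=
      ⟨_, _, (List.dropLast_append_getLast (List.cons_ne_nil u a)).symm⟩
    have hx : x ∈ S := hhead x (by rw [hax]; simp)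
    -- The pivot `y` follows the new head `x` on `q`. Were `z` the pivot, induction would make it a
    -- neighbour on `p` of `x ∈ S`.
    have hy : z ≠ y := by
      rintro rfl
      exact hzp x hx (ih (.inr ⟨a', b, by rw [hax]; simp⟩))
    have key : ∀ {c d}, FollowedBy ((u :: a).reverse ++ y :: b) c d →
        Neighbours (u :: a ++ y :: b) c d ∨ c = u ∧ d = y := by
      intro c d hcd
      rcases hcd.append with hcd | hcd | ⟨h₁, h₂⟩
      · exact .inl (.inr ((List.reverse_reverse (u :: a) ▸ hcd.reverse).append_left _))
      · exact .inl (.inl (hcd.append_right _))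
      · refine .inr ⟨?_, ?_⟩
        · simpa using h₁.symm
        · simpa using h₂.symm
    rcases h with h | h
    · rcases key h with h | ⟨rfl, -⟩
      · exact ih h
      · exact absurd hu hz
    · rcases key h with h | ⟨-, rfl⟩
      · exact ih h.symm
      · exact absurd rfl hy

/-- Pósa's lemma: a graph with an edge has a nonempty set `S` of vertices which, together with
its neighbours, lies on a cycle and has at most `3|S|` elements. -/
theorem exists_cycle_of_rotations [Finite V] (G : SimpleGraph V) {a b : V} (hab : G.Adj a b) :
    ∃ (u : V) (c : List V) (v : V) (S W : Finset V), (u :: c ++ [v]).Nodup ∧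
      (u :: c ++ [v]).IsChain G.Adj ∧ G.Adj v u ∧ S.Nonempty ∧ S ⊆ W ∧
      (∀ s ∈ S, ∀ w, G.Adj s w → w ∈ W) ∧ W.card ≤ 3 * S.card ∧
      ∀ w ∈ W, w ∈ u :: c ++ [v] := by
  classical
  have := Fintype.ofFinite V
  obtain ⟨p, hp, hpc, hp2, hmax⟩ := exists_longest_path G hab
  let S : Finset V := Finset.univ.filter fun s =>
    ∃ q, Relation.ReflTransGen (IsRotation G) p q ∧ s ∈ q.head?
  let W : Finset V := Finset.univ.filter fun w => w ∈ S ∨ ∃ s ∈ S, G.Adj s w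
  have memS : ∀ {s}, s ∈ S ↔ ∃ q, Relation.ReflTransGen (IsRotation G) p q ∧ s ∈ q.head? := by
    simp [S]
  have memW : ∀ {w}, w ∈ W ↔ w ∈ S ∨ ∃ s ∈ S, G.Adj s w := by simp [W]
  have hreach : ∀ q, Relation.ReflTransGen (IsRotation G) p q → q.Perm p ∧ q.IsChain G.Adj := by
    intro q hq
    induction hq with
    | refl => exact ⟨.refl _, hpc⟩
    | tail _ h ih => exact ⟨h.perm.trans ih.1, h.isChain ih.2⟩
  have hSp : ∀ s ∈ S, s ∈ p := by
    intro s hs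
    obtain ⟨q, hq, hsq⟩ := memS.1 hs
    exact (hreach q hq).1.mem_iff.1 (List.mem_of_mem_head? hsq)
  -- A neighbour of the head outside the path would extend a longest path.
  have hN : ∀ q, Relation.ReflTransGen (IsRotation G) p q → ∀ s ∈ q.head?, ∀ w, G.Adj s w →
      w ∈ q := by
    intro q hq s hs w hsw
    by_contra hw
    obtain ⟨hperm, hchain⟩ := hreach q hq
    obtain ⟨t, rfl⟩ := List.head?_eq_some_iff.1 hs
    have := hmax (w :: s :: t) (List.nodup_cons.2 ⟨hw, hperm.nodup_iff.2 hp⟩)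
      (List.isChain_cons_cons.2 ⟨hsw.symm, hchain⟩)
    have hlen := hperm.length_eq
    simp only [List.length_cons] at this hlen
    omega
  have hWp : ∀ w ∈ W, w ∈ p := by
    intro w hw
    rcases memW.1 hw with hw | ⟨s, hs, hsw⟩
    · exact hSp w hw
    · obtain ⟨q, hq, hsq⟩ := memS.1 hs
      exact (hreach q hq).1.mem_iff.1 (hN q hq s hsq w hsw)
  have hpne : p ≠ [] := by rintro rfl; simp at hp2
  have hSne : S.Nonempty :=
    ⟨p.head hpne, memS.2 ⟨p, .refl, List.head?_eq_some_head hpne⟩⟩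
  have hcard : W.card ≤ 3 * S.card := by
    choose T hT using exists_finset_neighbours hp
    -- Suppose `z` is adjacent to the head `s` of `q` but neither in `S` nor next to `S` on `p`.
    -- Rotating at `z` puts its predecessor `x` on `q` into `S`, and `neighbours_of_rotations` makes
    -- `x` and `z` consecutive already on `p`, a contradiction.
    have hsub : W ⊆ S.biUnion T := by
      intro z hz
      rw [Finset.mem_biUnion]
      by_cases hzS : z ∈ S
      · exact ⟨z, hzS, (hT z).1⟩
      · obtain ⟨s, hs, hsz⟩ := (memW.1 hz).resolve_left hzS
        by_contra hcon
        push Not at hcon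
        obtain ⟨q, hq, hsq⟩ := memS.1 hs
        have hzq := hN q hq s hsq z hsz
        obtain ⟨t, rfl⟩ := List.head?_eq_some_iff.1 hsq
        have hzt : z ∈ t := (List.mem_cons.1 hzq).resolve_left hsz.ne'
        obtain ⟨a, b, rfl⟩ := List.append_of_mem hzt
        obtain ⟨a', x, hax⟩ : ∃ a' x, s :: a = a' ++ [x] :=
          ⟨_, _, (List.dropLast_append_getLast (List.cons_ne_nil s a)).symm⟩
        have hx : x ∈ S :=
          memS.2 ⟨_, hq.tail ⟨s, a, z, b, rfl, hsz, rfl⟩, by rw [hax]; simp⟩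
        refine hcon x hx ((hT x).2.2 z ?_)
        refine neighbours_of_rotations (S := S) (fun q hq s hs => memS.2 ⟨q, hq, hs⟩) hq hzS
          (fun s hs h => hcon s hs ((hT s).2.2 z h)) (.inr ⟨a', b, ?_⟩)
        rw [← List.cons_append, hax]; simp
    refine (Finset.card_le_card hsub).trans (Finset.card_biUnion_le.trans ?_)
    rw [mul_comm]
    exact Finset.sum_le_card_nsmul _ _ _ fun s _ => (hT s).2.1
  -- `v` is the last vertex of `W` on `p`. Pivots lie in `W`, so no rotation touches the part from
  -- `v` on. Some head `u` is adjacent to `v`, and the edge `vu` closes a cycle that omits only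
  -- `b₀`.
  obtain ⟨a₀, v, b₀, hpab, hvW, hb₀⟩ : ∃ a v b, p = a ++ v :: b ∧ v ∈ W ∧ ∀ x ∈ b, x ∉ W :=
    exists_last_mem ⟨_, hSp _ hSne.choose_spec, memW.2 (.inl hSne.choose_spec)⟩
  have hsuffix : ∀ q, Relation.ReflTransGen (IsRotation G) p q → ∃ a', q = a' ++ v :: b₀ := by
    intro q hq
    induction hq with
    | refl => exact ⟨a₀, hpab⟩
    | @tail q q' hpq hqq' ih =>
      obtain ⟨a', ha'⟩ := ih
      obtain ⟨u, a, z, b, rfl, huz, rfl⟩ := hqq'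
      have hzW : z ∈ W := memW.2 (.inr ⟨u, memS.2 ⟨_, hpq, rfl⟩, huz⟩)
      rcases List.append_eq_append_iff.1 ha' with ⟨c, -, hc⟩ | ⟨c, hc₁, hc⟩
      · exact ⟨(u :: a).reverse ++ c, by rw [hc]; simp⟩
      · cases c with
        | nil => exact ⟨(u :: a).reverse, by rw [← List.nil_append (z :: b), ← hc]⟩
        | cons y c =>
          simp only [List.cons_append, List.cons.injEq] at hc
          exact absurd hzW (hb₀ z (by rw [hc.2]; simp))
  -- If `v` were a head, the path would be `v :: b₀`, and the vertex after `v` would be in `W`.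
  have hvS : v ∉ S := by
    intro hvS
    obtain ⟨q, hq, hvq⟩ := memS.1 hvS
    obtain ⟨hperm, hchain⟩ := hreach q hq
    obtain ⟨a', rfl⟩ := hsuffix q hq
    have hnd := hperm.nodup_iff.2 hp
    cases a' with
    | cons y a' =>
      simp only [List.cons_append, List.head?_cons, Option.mem_some_iff] at hvq
      subst hvq
      simp at hnd
    | nil =>
      cases b₀ with
      | nil =>
        have := hperm.length_eq
        simp only [List.nil_append, List.length_cons, List.length_nil] at this
        omega
      | cons y b₀ =>
        have hvy : G.Adj v y := (List.isChain_cons_cons.1 hchain).1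
        exact hb₀ y (by simp) (memW.2 (.inr ⟨v, hvS, hvy⟩))
  obtain ⟨u, hu, huv⟩ := (memW.1 hvW).resolve_left hvS
  obtain ⟨q, hq, huq⟩ := memS.1 hu
  obtain ⟨hperm, hchain⟩ := hreach q hq
  obtain ⟨a', rfl⟩ := hsuffix q hq
  cases a' with
  | nil =>
    simp only [List.nil_append, List.head?_cons, Option.mem_some_iff] at huq
    exact absurd huq.symm huv.ne
  | cons y a' =>
    simp only [List.cons_append, List.head?_cons, Option.mem_some_iff] at huq
    subst huq
    have hsplit : y :: a' ++ v :: b₀ = (y :: a' ++ [v]) ++ b₀ := by simp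
    have hnd := hperm.nodup_iff.2 hp
    rw [hsplit] at hnd hchain
    refine ⟨y, a', v, S, W, (List.nodup_append.1 hnd).1, (List.isChain_append.1 hchain).1,
      huv.symm, hSne, fun s hs => memW.2 (.inl hs), fun s hs w hw => memW.2 (.inr ⟨s, hs, hw⟩),
      hcard, fun w hw => ?_⟩
    have hwq := hperm.mem_iff.2 (hWp w hw)
    rw [hsplit, List.mem_append] at hwq
    exact hwq.resolve_right fun h => hb₀ w h hw

end Rotation

/-! ### Paths of prescribed even length in a cycle with a chord. -/

section Theta

theorem iff_of_periodic {f g : ℤ → Prop} {p a : ℤ} (hp : 0 < p) (hf : ∀ x, f (x + p) ↔ f x)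
    (hg : ∀ x, g (x + p) ↔ g x) (h : ∀ x, a ≤ x → x < a + p → (f x ↔ g x)) (x : ℤ) :
    f x ↔ g x := by
  have key : ∀ {f : ℤ → Prop}, (∀ x, f (x + p) ↔ f x) → ∀ (m x : ℤ), f (x + p * m) ↔ f x := by
    intro f hf m
    induction m using Int.induction_on with
    | zero => simp
    | succ m ih => intro x; rw [mul_add, mul_one, ← add_assoc, hf]; exact ih x
    | pred m ih =>
      intro x
      rw [← hf, ← ih x, mul_sub, mul_one]
      ring_nf
  have hx : x = a + (x - a) % p + p * ((x - a) / p) := by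
    have := Int.emod_add_mul_ediv (x - a) p
    linarith
  rw [hx, key hf, key hg]
  have h₁ := Int.emod_nonneg (x - a) hp.ne'
  have h₂ := Int.emod_lt_of_pos (x - a) hp
  exact h _ (by linarith) (by linarith)

/-- A two-colouring of the even vertices of a cycle of length `2n` with a chord `{0, 2q + 1}`
is invariant under the shift by two if no path of length `2j` joins vertices of different
colours. -/
theorem shift_invariant_of_chord {f : ℤ → Prop} {n j q : ℤ} (hj : 1 ≤ j) (hjn : j < n)
    (hq : 1 ≤ q) (hqn : q + 2 ≤ n) (hfn : ∀ x, f (x + n) ↔ f x) (hfj : ∀ x, f (x + j) ↔ f x)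
    (h₁ : ∀ s, 0 ≤ s → s ≤ j - 1 → j - q ≤ s → s ≤ n - q - 1 → (f (-s) ↔ f (q + 1 + s - j)))
    (h₂ : ∀ s, 0 ≤ s → s ≤ j - 1 → s ≤ q → j - s ≤ n - q - 1 → (f s ↔ f (q - s + j)))
    (h₃ : j ≤ n - q - 1 → ∀ s, 0 ≤ s → s ≤ j - 1 → (f (-s) ↔ f (q - s + j)))
    (h₄ : j ≤ q → ∀ s, 0 ≤ s → s ≤ j - 1 → (f s ↔ f (q + 1 + s - j))) (x : ℤ) :
    f (x + 1) ↔ f x := by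
  -- Paths that traverse both arcs in the same direction give translations: by `q + j` upwards here,
  -- by `q + 1 - j` downwards in `p₄`. The period `j` removes the `j`.
  have p₃ : j ≤ n - q - 1 → ∀ x, f (x + q) ↔ f x := by
    intro h x
    have := iff_of_periodic (f := f) (g := fun x => f (x + q + j)) (p := j) (a := -(j - 1))
      (by linarith) hfj (fun x => by rw [← hfj (x + q + j)]; ring_nf)
      (fun x hx hx' => by
        have := h₃ h (-x) (by linarith) (by linarith)
        rw [neg_neg] at this
        rw [this]; ring_nf) x
    rw [this, hfj]
  have p₄ : j ≤ q → ∀ x, f (x + (q + 1)) ↔ f x := by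
    intro h x
    have := iff_of_periodic (f := f) (g := fun x => f (x + q + 1 - j)) (p := j) (a := 0)
      (by linarith) hfj (fun x => by rw [← hfj (x + q + 1 - j)]; ring_nf)
      (fun x hx hx' => by
        rw [h₄ h x (by linarith) (by linarith)]; ring_nf) x
    rw [this, ← hfj (x + q + 1 - j)]
    ring_nf
  -- Paths that reverse direction at the chord give two reflections, whose composition is a shift by
  -- one up to multiples of `j`.
  have finish : (∀ x, f x ↔ f (q + 1 - j - x)) → (∀ x, f x ↔ f (q + j - x)) →
      (f (x + 1) ↔ f x) := by
    intro r₁ r₂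
    rw [r₁ (x + 1), r₂ x, ← hfj, ← hfj]
    ring_nf
  have reflect : ∀ {p a : ℤ} (b : ℤ), 0 < p → (∀ x, f (x + p) ↔ f x) →
      (∀ x, a ≤ x → x < a + p → (f x ↔ f (b - x))) → ∀ x, f x ↔ f (b - x) := by
    intro p a b hp hper h
    refine iff_of_periodic hp hper (fun x => ?_) h
    rw [← hper, show b - (x + p) + p = b - x by ring]
  have r₁ : ∀ x, 0 ≤ -x → -x ≤ j - 1 → j - q ≤ -x → -x ≤ n - q - 1 →
      (f x ↔ f (q + 1 - j - x)) := by
    intro x hx₁ hx₂ hx₃ hx₄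
    have := h₁ (-x) hx₁ hx₂ hx₃ hx₄
    rwa [neg_neg, show q + 1 + -x - j = q + 1 - j - x by ring] at this
  have r₂ : ∀ x, 0 ≤ x → x ≤ j - 1 → x ≤ q → j - x ≤ n - q - 1 → (f x ↔ f (q + j - x)) := by
    intro x hx₁ hx₂ hx₃ hx₄
    rw [h₂ x hx₁ hx₂ hx₃ hx₄, show q - x + j = q + j - x by ring]
  -- If both translations exist, the periods `q` and `q + 1` suffice. Otherwise the reflections are
  -- known only on a window, of exactly the length of an available period: `n - q - 1`, `q` or `n -
  -- j`.
  rcases le_or_gt j q with hjq | hjq <;> rcases le_or_gt j (n - q - 1) with hjn' | hjn'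
  · rw [← p₃ hjn', add_assoc, add_comm 1 q, p₄ hjq]
  · have hper : ∀ x, f (x + (n - q - 1)) ↔ f x := by
      intro x
      rw [← p₄ hjq, ← hfn x]; ring_nf
    refine finish (reflect (p := n - q - 1) (a := -(n - q - 2)) _ (by omega) hper fun x hx hx' => ?_)
      (reflect (p := n - q - 1) (a := j - (n - q - 1)) _ (by omega) hper fun x hx hx' => ?_)
    · exact r₁ x (by omega) (by omega) (by omega) (by omega)
    · exact r₂ x (by omega) (by omega) (by omega) (by omega)
  · refine finish (reflect (p := q) (a := 1 - j) _ (by omega) (p₃ hjn') fun x hx hx' => ?_)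
      (reflect (p := q) (a := 0) _ (by omega) (p₃ hjn') fun x hx hx' => ?_)
    · exact r₁ x (by omega) (by omega) (by omega) (by omega)
    · exact r₂ x (by omega) (by omega) (by omega) (by omega)
  · have hper : ∀ x, f (x + (n - j)) ↔ f x := by
      intro x
      rw [← hfj, ← hfn x]; ring_nf
    refine finish (reflect (p := n - j) (a := -(n - q - 1)) _ (by omega) hper fun x hx hx' => ?_)
      (reflect (p := n - j) (a := j - (n - q - 1)) _ (by omega) hper fun x hx hx' => ?_)
    · exact r₁ x (by omega) (by omega) (by omega) (by omega)
    · exact r₂ x (by omega) (by omega) (by omega) (by omega)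

variable {V : Type*} {G : SimpleGraph V}

/-- `c` runs periodically around a cycle of length `N`. -/
structure IsCyclicSeq (G : SimpleGraph V) (N : ℕ) (c : ℤ → V) : Prop where
  eq_iff : ∀ i j, c i = c j ↔ (N : ℤ) ∣ i - j
  adj : ∀ i, G.Adj (c i) (c (i + 1))

theorem exists_isCyclicSeq {u v : V} {l : List V} (hnd : (u :: l ++ [v]).Nodup)
    (hch : (u :: l ++ [v]).IsChain G.Adj) (hvu : G.Adj v u) :
    ∃ c : ℤ → V, IsCyclicSeq G (l.length + 2) c ∧ ∀ w ∈ u :: l ++ [v], ∃ i, c i = w := by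
  set L := u :: l ++ [v] with hL
  have hlen : L.length = l.length + 2 := by simp [hL]
  set N := l.length + 2
  have hN : (0 : ℤ) < N := by positivity
  have hlt : ∀ i : ℤ, (i % N).toNat < L.length := by
    intro i
    have h₁ := Int.emod_nonneg i hN.ne'
    have h₂ := Int.emod_lt_of_pos i hN
    omega
  refine ⟨fun i => L[(i % N).toNat]'(hlt i), ⟨fun i j => ?_, fun i => ?_⟩, fun w hw => ?_⟩
  · rw [hnd.getElem_inj_iff, Int.dvd_iff_emod_eq_zero, ← Int.emod_eq_emod_iff_emod_sub_eq_zero]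
    have h₁ := Int.emod_nonneg i hN.ne'
    have h₂ := Int.emod_nonneg j hN.ne'
    omega
  · have h₁ := Int.emod_nonneg i hN.ne'
    have h₂ := Int.emod_lt_of_pos i hN
    have hsucc : (i + 1) % N = (i % N + 1) % N := (Int.emod_add_emod i N 1).symm
    rcases eq_or_ne (i % N) (N - 1) with h | h
    · have h0 : (i + 1) % N = 0 := by
        rw [hsucc, h, sub_add_cancel, Int.emod_self]
      have hi : (i % N).toNat = l.length + 1 := by omega
      simp only [h0, hi, hL]
      simpa using hvu
    · have h0 : (i + 1) % N = i % N + 1 := by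
        rw [hsucc, Int.emod_eq_of_lt (by omega) (by omega)]
      have hi : (i % (N : ℤ) + 1).toNat = (i % N).toNat + 1 := by omega
      simp only [h0, hi]
      exact List.isChain_iff_getElem.1 hch _ (by omega)
  · obtain ⟨m, hm, rfl⟩ := List.getElem_of_mem hw
    refine ⟨m, ?_⟩
    have : ((m : ℤ) % N).toNat = m := by
      rw [Int.emod_eq_of_lt (by positivity) (by omega)]; simp
    simp only [this]

namespace IsCyclicSeq

variable {N : ℕ} {c : ℤ → V}

theorem shift (h : IsCyclicSeq G N c) (a : ℤ) : IsCyclicSeq G N fun x => c (x + a) where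
  eq_iff i j := by rw [h.eq_iff]; ring_nf
  adj i := by
    have := h.adj (i + a)
    rwa [add_right_comm] at this

theorem eq_of_window (h : IsCyclicSeq G N c) {i j : ℤ} (hij : c i = c j) (h₁ : i < j + N)
    (h₂ : j < i + N) : i = j := by
  have := Int.eq_zero_of_abs_lt_dvd ((h.eq_iff i j).1 hij) (by rw [abs_lt]; constructor <;> linarith)
  linarith

theorem disjoint_images (h : IsCyclicSeq G N c) {x₁ x₂ y₁ y₂ : ℤ} (h₁ : x₂ < y₁)
    (h₂ : y₂ < x₁ + N) : Disjoint (c '' Set.Icc x₁ x₂) (c '' Set.Icc y₁ y₂) := by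
  rw [Set.disjoint_left]
  rintro _ ⟨x, hx, rfl⟩ ⟨y, hy, hxy⟩
  have := h.eq_of_window hxy (by linarith [hx.1, hy.2]) (by linarith [hx.2, hy.1, Nat.cast_nonneg (α := ℤ) N])
  linarith [hx.2, hy.1]

theorem arc (h : IsCyclicSeq G N c) (x : ℤ) (n : ℕ) (hn : n < N) :
    PathIn G (c '' Set.Icc x (x + n)) (c x) (c (x + n)) n := by
  induction n with
  | zero =>
    have := PathIn.refl (G := G) (s := c '' Set.Icc x (x + (0 : ℕ))) (a := c x) ⟨x, by simp, rfl⟩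
    simpa using this
  | succ n ih =>
    have hstep := (ih (by omega)).join (h.adj (x + n))
      (PathIn.refl (G := G) (s := c '' Set.Icc (x + n + 1) (x + n + 1)) ⟨_, by simp, rfl⟩)
      (h.disjoint_images (by linarith) (by
        have : (n : ℤ) + 1 < N := by exact_mod_cast hn
        linarith))
    push_cast
    rw [← add_assoc]
    refine hstep.mono le_rfl ?_
    rw [← Set.image_union]
    refine Set.image_mono ?_
    rintro y (hy | hy)
    · exact ⟨hy.1, by linarith [hy.2]⟩
    · exact ⟨by linarith [hy.1, Nat.cast_nonneg (α := ℤ) n], hy.2⟩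

theorem arc' (h : IsCyclicSeq G N c) {x y : ℤ} (hxy : x ≤ y) (hy : y < x + N) :
    PathIn G (c '' Set.Icc x y) (c x) (c y) (y - x).toNat := by
  have := h.arc x (y - x).toNat (by omega)
  rwa [show x + ((y - x).toNat : ℤ) = y by omega] at this

/-- Two disjoint arcs joined by an edge between ends of the arcs form a path. -/
theorem join_arcs (h : IsCyclicSeq G N c) {x x' y y' x₁ x₂ y₁ y₂ : ℤ}
    {m n : ℕ} (hx : PathIn G (c '' Set.Icc x₁ x₂) (c x) (c x') m) (hadj : G.Adj (c x') (c y))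
    (hy : PathIn G (c '' Set.Icc y₁ y₂) (c y) (c y') n) (h₁ : x₂ < y₁) (h₂ : y₂ < x₁ + N) :
    PathIn G (Set.range c) (c x) (c y') (m + 1 + n) :=
  (hx.join hadj hy (h.disjoint_images h₁ h₂)).mono le_rfl
    (Set.union_subset (Set.image_subset_range _ _) (Set.image_subset_range _ _))

/-- In a cycle of even length with a chord joining vertices at odd distance, any splitting of the
even vertices into two nonempty classes is crossed by a path of every even length that is less
than the length of the cycle. -/
theorem exists_crossing_path (h : IsCyclicSeq G N c) {n j q : ℕ} (hN : N = 2 * n)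
    (hj : 1 ≤ j) (hjn : j < n) (hq : 1 ≤ q) (hqn : q + 2 ≤ n)
    (hchord : G.Adj (c 0) (c (2 * q + 1))) (A : Set V) {x₀ y₀ : ℤ} (hx₀ : c (2 * x₀) ∈ A)
    (hy₀ : c (2 * y₀) ∉ A) :
    ∃ x y : ℤ, c (2 * x) ∈ A ∧ c (2 * y) ∉ A ∧
      PathIn G (Set.range c) (c (2 * x)) (c (2 * y)) (2 * j) := by
  by_contra hcon
  push Not at hcon
  have hiff : ∀ x y : ℤ, PathIn G (Set.range c) (c (2 * x)) (c (2 * y)) (2 * j) →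
      (c (2 * x) ∈ A ↔ c (2 * y) ∈ A) := fun x y hp =>
    ⟨fun hx => by_contra fun hy => hcon x y hx hy hp,
      fun hy => by_contra fun hx => hcon y x hy hx hp.symm⟩
  -- Without a crossing path, membership in `A` agrees at the ends of every path of length `2j`:
  -- single arcs give the period `j`, pairs of arcs joined by the chord the rest. Shift invariance
  -- then makes the splitting trivial.
  have hshift := shift_invariant_of_chord (f := fun x => c (2 * x) ∈ A) (n := n) (j := j) (q := q)
    (by omega) (by omega) (by omega) (by omega)
    (fun x => by rw [show c (2 * (x + n)) = c (2 * x) from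
      (h.eq_iff _ _).2 ⟨1, by rw [hN]; push_cast; ring⟩])
    (fun x => (hiff x (x + j) (by
      have := h.arc' (x := 2 * x) (y := 2 * (x + j)) (by omega) (by omega)
      rw [show (2 * (x + (j : ℤ)) - 2 * x).toNat = 2 * j by omega] at this
      exact this.mono le_rfl (Set.image_subset_range _ _))).symm)
    (fun s h0 hs₁ hs₂ hs₃ => hiff _ _ (by
      have := h.join_arcs (h.arc' (x := 2 * -s) (y := 0) (by omega) (by omega)) hchord
        (h.arc' (x := 2 * (q + 1 + s - j)) (y := 2 * q + 1) (by omega) (by omega)).symm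
        (by omega) (by omega)
      convert this using 1
      omega))
    (fun s h0 hs₁ hs₂ hs₃ => hiff _ _ (by
      have := h.join_arcs (h.arc' (x := 0) (y := 2 * s) (by omega) (by omega)).symm hchord
        (h.arc' (x := 2 * q + 1) (y := 2 * (q - s + j)) (by omega) (by omega))
        (by omega) (by omega)
      convert this using 1
      omega))
    (fun hle s h0 hs₁ => hiff _ _ (by
      have := h.join_arcs (h.arc' (x := 2 * -s) (y := 0) (by omega) (by omega)) hchord
        (h.arc' (x := 2 * q + 1) (y := 2 * (q - s + j)) (by omega) (by omega))
        (by omega) (by omega)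
      convert this using 1
      omega))
    (fun hle s h0 hs₁ => hiff _ _ (by
      have := h.join_arcs (h.arc' (x := 0) (y := 2 * s) (by omega) (by omega)).symm hchord
        (h.arc' (x := 2 * (q + 1 + s - j)) (y := 2 * q + 1) (by omega) (by omega)).symm
        (by omega) (by omega)
      convert this using 1
      omega))
  have hall := iff_of_periodic (f := fun x => c (2 * x) ∈ A) (g := fun _ => c (2 * x₀) ∈ A)
    (p := 1) (a := x₀) one_pos hshift (fun _ => Iff.rfl) (fun x h₁ h₂ => by
      rw [show x = x₀ by omega]) y₀
  exact hy₀ (hall.2 hx₀)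

end IsCyclicSeq

end Theta

/-! ### Closing paths to cycles through the breadth-first tree. -/

section Tree

variable {V : Type*} {G : SimpleGraph V}

theorem layer_iterate {h : V → ℕ} {π : V → V}
    (hπ : ∀ v, h v ≠ 0 → G.Adj v (π v) ∧ h (π v) + 1 = h v) {v : V} {s : ℕ} (hs : s ≤ h v) :
    h (π^[s] v) + s = h v := by
  induction s with
  | zero => rfl
  | succ s ih =>
    have := ih (by omega)
    rw [Function.iterate_succ_apply']
    have := (hπ (π^[s] v) (by omega)).2
    omega

theorem reachable_iterate {h : V → ℕ} {π : V → V}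
    (hπ : ∀ v, h v ≠ 0 → G.Adj v (π v) ∧ h (π v) + 1 = h v) {v : V} {s : ℕ} (hs : s ≤ h v) :
    G.Reachable v (π^[s] v) := by
  induction s with
  | zero => exact SimpleGraph.Reachable.refl _
  | succ s ih =>
    have := layer_iterate hπ (show s ≤ h v by omega)
    rw [Function.iterate_succ_apply']
    exact (ih (by omega)).trans (hπ (π^[s] v) (by omega)).1.reachable

/-- A path above the layer `i` between vertices of the layer `i` is closed to a cycle through the
lowest common ancestor of its ends. -/
theorem hasCycle_of_path_of_ancestors {h : V → ℕ} {π : V → V}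
    (hπ : ∀ v, h v ≠ 0 → G.Adj v (π v) ∧ h (π v) + 1 = h v) {a b : V} {i t m : ℕ}
    (ha : h a = i) (hb : h b = i) (hti : t + 1 ≤ i) (ht : π^[t] a ≠ π^[t] b)
    (ht' : π^[t + 1] a = π^[t + 1] b) (hm : 1 ≤ m) (hp : PathIn G {v | i ≤ h v} a b m) :
    HasCycle G (m + 2 * t + 2) := by
  have hadj : ∀ {v s}, h v = i → s < i → G.Adj (π^[s] v) (π^[s + 1] v) := by
    intro v s hv hs
    have := layer_iterate hπ (show s ≤ h v by omega)
    rw [Function.iterate_succ_apply']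
    exact (hπ _ (by omega)).1
  have hlow : ∀ {v s}, h v = i → s < i →
      Disjoint ({π^[s + 1] v} : Set V) {w | i ≤ h w + s} := by
    intro v s hv hs
    have := layer_iterate hπ (show s + 1 ≤ h v by omega)
    rw [Set.disjoint_singleton_left, Set.mem_ofPred_eq]
    omega
  -- The path is extended by the parents of both ends, one layer at a time. They are new, lying
  -- below all earlier vertices, and distinct, since the ancestors differ up to step `t`.
  have climb : ∀ s ≤ t, PathIn G {v | i ≤ h v + s} (π^[s] a) (π^[s] b) (m + 2 * s) := by
    intro s
    induction s with
    | zero => exact fun _ => hp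
    | succ s ih =>
      intro hs
      have hne : π^[s + 1] a ≠ π^[s + 1] b := by
        intro heq
        refine ht ?_
        rw [show t = (t - (s + 1)) + (s + 1) by omega, Function.iterate_add_apply π _ (s + 1) a,
          Function.iterate_add_apply π _ (s + 1) b, heq]
      have h₁ := (PathIn.refl (G := G) (Set.mem_singleton (π^[s + 1] a))).join
        (hadj ha (by omega)).symm (ih (by omega)) (hlow ha (by omega))
      have h₂ := h₁.join (hadj hb (by omega))
        (PathIn.refl (G := G) (Set.mem_singleton (π^[s + 1] b))) (by
          rw [Set.disjoint_union_left]
          exact ⟨by simpa using hne, (hlow hb (by omega)).symm⟩)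
      have h₃ := layer_iterate hπ (show s + 1 ≤ h a by omega)
      have h₄ := layer_iterate hπ (show s + 1 ≤ h b by omega)
      rw [show m + 2 * (s + 1) = 0 + 1 + (m + 2 * s) + 1 + 0 by omega]
      refine h₂.mono le_rfl ?_
      rintro v ((rfl | hv) | rfl)
      · simp only [Set.mem_ofPred_eq]; omega
      · simp only [Set.mem_ofPred_eq] at hv ⊢; omega
      · simp only [Set.mem_ofPred_eq]; omega
  have htop := (PathIn.refl (G := G) (Set.mem_singleton (π^[t + 1] a))).join
    (hadj ha (by omega)).symm (climb t le_rfl) (hlow ha (by omega))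
  have := htop.hasCycle (by omega) (ht' ▸ hadj hb (by omega))
  rwa [show 0 + 1 + (m + 2 * t) + 1 = m + 2 * t + 2 by omega] at this

/-- A cycle of length `2n` with a chord between two consecutive layers of a breadth-first layering
yields cycles of `n - 1` consecutive even lengths. -/
theorem exists_cycles_of_chorded_cycle {F : SimpleGraph V} (hFG : F ≤ G) {h : V → ℕ} {π : V → V}
    (hπ : ∀ v, h v ≠ 0 → G.Adj v (π v) ∧ h (π v) + 1 = h v)
    (hroot : ∀ u v, h u = 0 → h v = 0 → G.Reachable u v → u = v) {i n q : ℕ} {c : ℤ → V}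
    (hc : IsCyclicSeq F (2 * n) c) (heven : ∀ x, h (c (2 * x)) = i)
    (hodd : ∀ x, h (c (2 * x + 1)) = i + 1) (hq : 1 ≤ q) (hqn : q + 2 ≤ n)
    (hchord : F.Adj (c 0) (c (2 * q + 1))) :
    ∃ t, ∀ j, 1 ≤ j → j < n → HasCycle G (2 * j + 2 * t + 2) := by
  classical
  have hreach : ∀ x y : ℤ, G.Reachable (c (2 * x)) (c (2 * y)) := by
    have hstep : ∀ x, G.Reachable (c 0) (c x) := by
      intro x
      induction x using Int.induction_on with
      | zero => exact SimpleGraph.Reachable.refl _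
      | succ x ih => exact ih.trans (hFG (hc.adj x)).reachable
      | pred x ih =>
        refine ih.trans (hFG ?_).reachable.symm
        simpa using hc.adj (-x - 1)
    exact fun x y => (hstep _).symm.trans (hstep _)
  have hi : ∀ x y : ℤ, π^[i] (c (2 * x)) = π^[i] (c (2 * y)) := by
    intro x y
    have hx : i ≤ h (c (2 * x)) := (heven x).ge
    have hy : i ≤ h (c (2 * y)) := (heven y).ge
    have h₁ := layer_iterate hπ hx
    have h₂ := layer_iterate hπ hy
    rw [heven] at h₁ h₂
    exact hroot _ _ (by omega) (by omega)
      ((reachable_iterate hπ hx).symm.trans ((hreach x y).trans (reachable_iterate hπ hy)))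
  -- At the least such number, `t + 1`, all even vertices first have a common ancestor. Their `t`-th
  -- ancestors split them into at least two classes, and vertices of different classes meet exactly
  -- at step `t + 1`, whence the uniform `2 * t + 2`.
  have hex : ∃ t, ∀ x y : ℤ, π^[t] (c (2 * x)) = π^[t] (c (2 * y)) := ⟨i, hi⟩
  obtain ⟨t, ht⟩ : ∃ t, Nat.find hex = t + 1 := by
    refine Nat.exists_eq_succ_of_ne_zero fun h0 => ?_
    have := Nat.find_spec hex 0 1
    rw [h0] at this
    have := hc.eq_of_window (i := 2 * 0) (j := 2 * 1) this (by omega) (by omega)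
    omega
  have hspec := Nat.find_spec hex
  have hmin := Nat.find_min hex (m := t) (by omega)
  have hle := Nat.find_min' hex hi
  rw [ht] at hspec hle
  push Not at hmin
  obtain ⟨x₀, y₀, hxy⟩ := hmin
  refine ⟨t, fun j hj hjn => ?_⟩
  obtain ⟨x, y, hx, hy, hp⟩ := hc.exists_crossing_path rfl hj hjn hq hqn hchord
    {v | π^[t] v = π^[t] (c (2 * x₀))} (x₀ := x₀) (y₀ := y₀) rfl hxy.symm
  refine hasCycle_of_path_of_ancestors hπ (heven x) (heven y) hle ?_ (hspec x y) (by omega)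
    (hp.mono hFG ?_)
  · intro heq
    exact hy (heq.symm.trans hx)
  · rintro _ ⟨z, rfl⟩
    obtain ⟨w, rfl | rfl⟩ := Int.even_or_odd' z
    · exact (heven w).ge
    · exact (hodd w).ge.trans' (Nat.le_succ i)

end Tree

/-! ### From density to a long chorded cycle, and residues. -/

section Main

variable {V : Type*}

/-- A vertex of a cyclic sequence with three neighbours on it has one that is not next to it. -/
theorem exists_chord {F : SimpleGraph V} {c : ℤ → V} {a : ℤ}
    {T : Finset V} (hT : 3 ≤ T.card) (hadj : ∀ w ∈ T, F.Adj (c a) w ∧ ∃ b, c b = w) :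
    ∃ b, F.Adj (c a) (c b) ∧ c b ≠ c (a + 1) ∧ c b ≠ c (a - 1) := by
  classical
  obtain ⟨w, hw, hw'⟩ : ∃ w ∈ T, w ∉ ({c (a + 1), c (a - 1)} : Finset V) := by
    by_contra! hcon
    have := (Finset.card_le_card hcon).trans Finset.card_le_two
    omega
  obtain ⟨h₁, b, rfl⟩ := hadj w hw
  simp only [Finset.mem_insert, Finset.mem_singleton, not_or] at hw'
  exact ⟨b, h₁, hw'⟩

/-- A cyclic sequence between two layers, with a chord, can be shifted so that the chord starts at
the even index `0` in the lower layer. -/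
theorem exists_cycles_of_chord {F G : SimpleGraph V} (hFG : F ≤ G) {h : V → ℕ} {π : V → V}
    (hπ : ∀ v, h v ≠ 0 → G.Adj v (π v) ∧ h (π v) + 1 = h v)
    (hroot : ∀ u v, h u = 0 → h v = 0 → G.Reachable u v → u = v) {i N : ℕ}
    (hF : ∀ u v, F.Adj u v → h u = i ∧ h v = i + 1 ∨ h u = i + 1 ∧ h v = i) {c : ℤ → V}
    (hc : IsCyclicSeq F N c) (hN : 1 ≤ N) {a b : ℤ} (hab : F.Adj (c a) (c b))
    (h₁ : c b ≠ c (a + 1)) (h₂ : c b ≠ c (a - 1)) :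
    ∃ t, ∀ j, 1 ≤ j → 2 * j < N → HasCycle G (2 * j + 2 * t + 2) := by
  wlog ha : h (c a) = i generalizing a b
  · have hb : h (c b) = i := by have := hF _ _ hab; omega
    refine this hab.symm (fun h => h₂ ?_) (fun h => h₁ ?_) hb
    · rw [hc.eq_iff] at h ⊢
      have := dvd_neg.2 h
      rwa [show -(a - (b + 1)) = b - (a - 1) by ring] at this
    · rw [hc.eq_iff] at h ⊢
      have := dvd_neg.2 h
      rwa [show -(a - (b - 1)) = b - (a + 1) by ring] at this
  have hc' := hc.shift a
  set c' : ℤ → V := fun x => c (x + a) with hc'def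
  have hpar : ∀ x, h (c' (2 * x)) = i ∧ h (c' (2 * x + 1)) = i + 1 := by
    have hfirst : ∀ x, h (c' x) = i → h (c' (x + 1)) = i + 1 := by
      intro x hx
      have := hF _ _ (hc'.adj x)
      omega
    have hsecond : ∀ x, h (c' x) = i + 1 → h (c' (x + 1)) = i := by
      intro x hx
      have := hF _ _ (hc'.adj x)
      omega
    have hfirst' : ∀ x, h (c' (x + 1)) = i → h (c' x) = i + 1 := by
      intro x hx
      have := hF _ _ (hc'.adj x)
      omega
    have hsecond' : ∀ x, h (c' (x + 1)) = i + 1 → h (c' x) = i := by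
      intro x hx
      have := hF _ _ (hc'.adj x)
      omega
    suffices ∀ x, h (c' (2 * x)) = i from fun x => ⟨this x, hfirst _ (this x)⟩
    intro x
    induction x using Int.induction_on with
    | zero => simpa [hc'def] using ha
    | succ x ih =>
      have := hsecond _ (hfirst _ ih)
      rwa [show 2 * (x : ℤ) + 1 + 1 = 2 * (x + 1) by ring] at this
    | pred x ih =>
      refine hsecond' _ (hfirst' _ ?_)
      rwa [show 2 * (-(x : ℤ) - 1) + 1 + 1 = 2 * -x by ring]
  have hNpos : (0 : ℤ) < N := by exact_mod_cast hN
  obtain ⟨n, hn⟩ : Even N := by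
    rw [← Nat.not_odd_iff_even]
    rintro ⟨n, hn⟩
    have h₃ : c' N = c' 0 := (hc'.eq_iff _ _).2 ⟨1, by ring⟩
    have h₄ := (hpar n).2
    have h₅ := (hpar 0).1
    rw [show 2 * (n : ℤ) + 1 = N by rw [hn]; push_cast; ring, h₃] at h₄
    rw [mul_zero] at h₅
    omega
  obtain rfl : N = 2 * n := by omega
  set r := (b - a) % ((2 * n : ℕ) : ℤ) with hr
  have hr₀ : 0 ≤ r := Int.emod_nonneg _ hNpos.ne'
  have hr₁ : r < (2 * n : ℕ) := Int.emod_lt_of_pos _ hNpos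
  have hcr : c' r = c b := by
    rw [hc'def]
    simp only
    rw [hc.eq_iff]
    have := Int.emod_add_mul_ediv (b - a) ((2 * n : ℕ) : ℤ)
    exact ⟨-((b - a) / ((2 * n : ℕ) : ℤ)), by rw [← hr] at this; linarith⟩
  have hc0 : c' 0 = c a := by simp [hc'def]
  have hhb : h (c' r) = i + 1 := by
    have := hF _ _ hab
    rw [hcr]; omega
  obtain ⟨q, hq | hq⟩ := Int.even_or_odd' r
  · rw [hq, (hpar q).1] at hhb
    omega
  -- As `r = 2 * q + 1` is neither `1` nor `2 * n - 1`, the bounds `1 ≤ q` and `q + 2 ≤ n` follow.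
  have hr1 : r ≠ 1 := fun h => h₁ (by rw [← hcr, h]; simp [hc'def, add_comm])
  have hrN : r ≠ (2 * n : ℕ) - 1 := fun h => h₂ (by
    rw [← hcr, h]
    simp only [hc'def]
    rw [hc.eq_iff]
    exact ⟨1, by ring⟩)
  lift q to ℕ using by omega
  obtain ⟨t, ht⟩ := exists_cycles_of_chorded_cycle hFG hπ hroot hc' (fun x => (hpar x).1)
    (fun x => (hpar x).2) (n := n) (q := q) (by omega) (by push_cast at hrN hr₁; omega)
    (by rw [← hq, hcr, hc0]; exact hab)
  exact ⟨t, fun j hj hjn => ht j hj (by omega)⟩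

theorem hasConsecutiveEvenCycles_of_avgDegree [Fintype V] {k ℓ : ℕ} (hk : 2 ≤ k)
    {G : SimpleGraph V} (hG : ¬ HasCycle G ℓ) (hd : 96 * maxDeg k ℓ ≤ avgDegree G) :
    HasConsecutiveEvenCycles G k := by
  classical
  have hd1 : 1 ≤ maxDeg k ℓ := one_le_maxDeg hk
  set d := maxDeg k ℓ with hd_def
  rcases isEmpty_or_nonempty V with hV | hV
  · simp [avgDegree] at hd
    linarith
  obtain ⟨f, hf⟩ := exists_pairCount_le_two_mul_cutGraph G
  set B := cutGraph G f
  have hBG : B ≤ G := fun _ _ h => h.1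
  have hBf : ∀ u v, B.Adj u v → f u ≠ f v := fun _ _ h => h.2
  obtain ⟨h, π, hh, hπ, hroot⟩ := exists_layering f hBf
  have hcount : 2 * (24 * d) * Fintype.card V ≤ pairCount B Finset.univ := by
    rw [pairCount_univ] at hf
    have : 96 * d * Fintype.card V ≤ avgDegree G * Fintype.card V :=
      mul_le_mul_of_nonneg_right hd (Nat.cast_nonneg _)
    linarith
  obtain ⟨i, U₀, hU₀, hdense⟩ := exists_dense_layerGraph hh (by positivity) hcount
  obtain ⟨U, hU, hdeg⟩ := exists_subset_min_degree (layerGraph B h i) (c := 12 * d)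
    (by positivity) U₀ hU₀ (by linarith)
  set F := restrictTo (layerGraph B h i) U with hFdef
  have hFB : F ≤ B := fun _ _ h => h.1.1
  have hFU : ∀ u v, F.Adj u v → u ∈ U := fun _ _ h => h.2.1
  have hFdeg : ∀ u ∈ U, 12 * d < ((U.filter fun v => F.Adj u v).card : ℝ) := by
    intro u hu
    refine (hdeg u hu).trans_le ?_
    norm_cast
    refine Finset.card_le_card fun v hv => ?_
    rw [Finset.mem_filter] at hv ⊢
    exact ⟨hv.1, hv.2, hu, hv.1⟩
  obtain ⟨a, ha⟩ := hU
  obtain ⟨b, hab⟩ : ∃ b, F.Adj a b := by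
    have : 0 < (U.filter fun v => F.Adj a v).card := by
      have := hFdeg a ha
      have : (0 : ℝ) < (U.filter fun v => F.Adj a v).card := by linarith
      exact_mod_cast this
    obtain ⟨b, hb⟩ := Finset.card_pos.1 this
    exact ⟨b, (Finset.mem_filter.1 hb).2⟩
  obtain ⟨u, l, v, S, W, hnd, hch, hvu, hS, hSW, hSN, hcard, hWl⟩ :=
    exists_cycle_of_rotations F hab
  obtain ⟨c, hc, hcl⟩ := exists_isCyclicSeq hnd hch hvu
  have hSU : ∀ s ∈ S, s ∈ U := by
    intro s hs
    obtain ⟨x, rfl⟩ := hcl s (hWl s (hSW hs))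
    exact hFU _ _ (hc.adj x)
  -- All `F`-neighbours of `S` lie in `W`, so a small `W` would span more than `12 * d * |S| ≥ 4 * d
  -- * |W|` pairs, against `pairCount_le`.
  have hW : 2 * k + 1 < W.card := by
    by_contra! hcon
    have hbip : F.IsBipartite := by
      have C : F.Coloring Bool := SimpleGraph.Coloring.mk f fun {a b} h => hBf a b (hFB h)
      simpa using! C.colorable
    have hle := pairCount_le (k := k) hbip (fun h' => hG (h'.mono (hFB.trans hBG))) hk hcon
    have hge : 12 * d * S.card < pairCount F W := by
      calc 12 * d * S.card = ∑ s ∈ S, 12 * d := by rw [Finset.sum_const, nsmul_eq_mul]; ring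
        _ < ∑ s ∈ S, ∑ w ∈ W, if F.Adj s w then (1 : ℝ) else 0 := by
          refine Finset.sum_lt_sum_of_nonempty hS fun s hs => (hFdeg s (hSU s hs)).trans_le ?_
          rw [Finset.sum_boole]
          norm_cast
          refine Finset.card_le_card fun w hw => ?_
          rw [Finset.mem_filter] at hw ⊢
          exact ⟨hSN s hs w hw.2, hw.2⟩
        _ ≤ pairCount F W := by
          refine Finset.sum_le_sum_of_subset_of_nonneg hSW fun _ _ _ => ?_
          exact Finset.sum_nonneg fun _ _ => by split_ifs <;> norm_num
    have : (W.card : ℝ) ≤ 3 * S.card := by exact_mod_cast hcard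
    have : 4 * d * (W.card : ℝ) ≤ 4 * d * (3 * S.card) :=
      mul_le_mul_of_nonneg_left this (by positivity)
    linarith
  have hlen : W.card ≤ l.length + 2 := by
    have : W ⊆ (u :: l ++ [v]).toFinset := fun w hw => List.mem_toFinset.2 (hWl w hw)
    refine (Finset.card_le_card this).trans ((List.toFinset_card_le _).trans ?_)
    simp
  obtain ⟨s, hs⟩ := hS
  obtain ⟨x, hx⟩ := hcl s (hWl s (hSW hs))
  have h3 : 3 ≤ (U.filter fun v => F.Adj s v).card := by
    have := hFdeg s (hSU s hs)
    have : (2 : ℝ) < (U.filter fun v => F.Adj s v).card := by linarith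
    exact_mod_cast this
  obtain ⟨y, hxy, hy₁, hy₂⟩ := exists_chord (a := x) h3 (fun w hw => by
    have hsw := (Finset.mem_filter.1 hw).2
    exact ⟨hx ▸ hsw, hcl w (hWl w (hSN s hs w hsw))⟩)
  obtain ⟨t, ht⟩ := exists_cycles_of_chord hFB hπ hroot (i := i) (fun _ _ h => h.1.2) hc
    (by omega) hxy hy₁ hy₂
  -- Crossing paths have length at least 2, so the `j`-th cycle uses one of length `2 * (j + 1) ≤ 2
  -- * k`, which is less than the length of the long cycle.
  refine ⟨t + 2, fun j hj => ?_⟩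
  have := ht (j + 1) (by omega) (by omega)
  rw [show 2 * (t + 2) + 2 * j = 2 * (j + 1) + 2 * t + 2 by ring]
  exact this.mono hBG

theorem HasConsecutiveEvenCycles.hasCycleMod {G : SimpleGraph V} {k ℓ : ℕ} (hk : 0 < k)
    (h : HasConsecutiveEvenCycles G k) (heven : ∃ m : ℤ, Even ((k : ℤ) * m + (ℓ : ℤ))) :
    HasCycleMod G k ℓ := by
  obtain ⟨m, hm⟩ := h
  obtain ⟨z, e, he⟩ := heven
  have hkZ : (0 : ℤ) < k := by exact_mod_cast hk
  have h₁ := Int.emod_nonneg (e - m) hkZ.ne'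
  have h₂ := Int.emod_lt_of_pos (e - m) hkZ
  have h₃ := Int.emod_add_mul_ediv (e - m) k
  -- Here `k * z + ℓ = e + e`, so a length `2 * (m + i)` is in the right class as soon as `i ≡ e -
  -- m` modulo `k`.
  refine ⟨2 * m + 2 * ((e - m) % k).toNat, ?_, hm _ (by omega)⟩
  rw [← Int.natCast_modEq_iff]
  push_cast
  rw [Int.toNat_of_nonneg h₁]
  refine (Int.modEq_iff_dvd.2 ⟨2 * ((e - m) / k) - z, ?_⟩)
  linear_combination he - 2 * h₃

theorem not_hasCycleMod_fin {k ℓ : ℕ} (hℓ : 3 ≤ ℓ) (hk : ℓ < k) {G : SimpleGraph (Fin k)}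
    (hG : ¬ HasCycle G ℓ) : ¬ HasCycleMod G k ℓ := by
  rintro ⟨n, hn, hc⟩
  have hle := hc.le_card
  rw [Fintype.card_fin] at hle
  have h3 := hc.exists_path.1
  rcases hle.lt_or_eq with hlt | rfl
  · rw [Nat.ModEq, Nat.mod_eq_of_lt hlt, Nat.mod_eq_of_lt hk] at hn
    exact hG (hn ▸ hc)
  · rw [Nat.ModEq, Nat.mod_self, Nat.mod_eq_of_lt hk] at hn
    omega

end Main

end CycleLengths

theorem theorem1 (k ℓ : ℕ) (hℓ : 3 ≤ ℓ) (hk : ℓ < k) :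
    (∀ (V : Type*) [Fintype V] (G : SimpleGraph V),
      ¬ CycleLengths.HasCycle G ℓ →
      96 * CycleLengths.maxDeg k ℓ ≤ CycleLengths.avgDegree G →
      CycleLengths.HasConsecutiveEvenCycles G k) ∧
    ((∃ m : ℤ, Even ((k : ℤ) * m + (ℓ : ℤ))) →
      96 * CycleLengths.maxDeg k ℓ ∈ CycleLengths.cycleModThresholds k ℓ ∧
      CycleLengths.maxDeg k ℓ ≤ CycleLengths.cycleModThreshold k ℓ ∧
      CycleLengths.cycleModThreshold k ℓ ≤ 96 * CycleLengths.maxDeg k ℓ) := by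

  refine ⟨fun V _ G hG hd =>
    CycleLengths.hasConsecutiveEvenCycles_of_avgDegree (by omega) hG hd, fun heven => ?_⟩
  have hmem : 96 * CycleLengths.maxDeg k ℓ ∈ CycleLengths.cycleModThresholds k ℓ := by
    intro V _ G hd
    by_cases hG : CycleLengths.HasCycle G ℓ
    · exact ⟨ℓ, rfl, hG⟩
    · exact (CycleLengths.hasConsecutiveEvenCycles_of_avgDegree (by omega) hG hd).hasCycleMod
        (by omega) heven
  have hlower : ∀ c ∈ CycleLengths.cycleModThresholds k ℓ, CycleLengths.maxDeg k ℓ ≤ c := by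
    intro c hc
    by_contra! hlt
    obtain ⟨G, -, hG, hd⟩ := (CycleLengths.isGreatest_maxDeg k (ℓ := ℓ)).1
    exact CycleLengths.not_hasCycleMod_fin hℓ hk hG (hc (Fin k) G (hd ▸ hlt.le))
  exact ⟨hmem, le_csInf ⟨_, hmem⟩ hlower, csInf_le ⟨_, hlower⟩ hmem⟩
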